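/- Work over $\mathbb{C}$, let $S=\mathbb{C}[x,y,z]$, and let $d\ge 1$ be an integer. For a reduced plane curve $C:F=0$ in $\mathbb{P}^2$, an inflection point is a smooth point $p\in C$ with $(C,T_pC)_p>2$, and an inflectional tangent is the tangent line $T_pC$ at an inflection point. The reduced curve $C:F=0$ is free with exponents $(d_1,d_2)$ if the graded $S$-module $D_0(F)=\{\partial\in \mathrm{Der}_{\mathbb C}(S):\partial F=0\}$ is free with a homogeneous basis of degrees $d_1,d_2$. A reduced curve of degree $n$ with only ADE singularities and total Tjurina number $\tau$ is maximizing if $n=2m$ and $\tau=3m(m-1)+1$, or $n=2m+1$ and $\tau=3m^2+1$. **Theorem.** The Fermat curve $C: x^d+y^d+z^d=0$ is smooth. Let $\mathcal{A}$ be the line arrangement $$\mathcal{A}: (x^d+y^d)(y^d+z^d)(x^d+z^d)=0.$$ (1) If $d\ge 3$, then $C$ has exactly $3d$ inflectional tangents, and their union is $\mathcal{A}$. (2) The union of $C$, the lines in $\mathcal{A}$ and the three coordinate axes is the reduced curve $$C': xyz(x^d+y^d)(y^d+z^d)(x^d+z^d)(x^d+y^d+z^d)=0$$ of degree $4d+3$,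 and it is free with exponents $(2d+1,2d+1)$. (3) The curve $C''\subset C'$ given by $$C'': xy(y^d+z^d)(x^d+z^d)(x^d+y^d+z^d)=0$$ is reduced of degree $3d+2$, and it is free with exponents $(d+1,2d)$. (4) If $d=2$, then $C''$ is maximizing of degree $8$. -/

import Mathlib

open MvPolynomial Topology
open scoped LinearAlgebra.Projectivization

noncomputable section

namespace PlaneCurve

/-- The graded polynomial ring `S = ℂ[x, y, z]`, with `x = X 0`, `y = X 1`, `z = X 2`. -/
abbrev S : Type := MvPolynomial (Fin 3) ℂ

/-- The complex projective plane. -/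
abbrev P2 : Type := ℙ ℂ (Fin 3 → ℂ)

/-- `F = 0` is a reduced plane curve of degree `n`. -/
def IsReducedCurve (F : S) (n : ℕ) : Prop := F.IsHomogeneous n ∧ Squarefree F

/-- The set of points of `ℙ²` on the curve `F = 0`, for `F` homogeneous. -/
def zeroLocus (F : S) : Set P2 := {p | eval p.rep F = 0}

/-- `p` is a singular point of the curve `F = 0`. -/
def IsSingularPoint (F : S) (p : P2) : Prop :=
  p ∈ zeroLocus F ∧ ∀ i, eval p.rep (pderiv i F) = 0

/-- `p` is a smooth point of the curve `F = 0`. -/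
def IsSmoothPoint (F : S) (p : P2) : Prop :=
  p ∈ zeroLocus F ∧ ∃ i, eval p.rep (pderiv i F) ≠ 0

/-! ### Inflectional tangents -/

/-- The projective tangent line of `F = 0` at a smooth point `p`, as a set of points of `ℙ²`. -/
def tangentLine (F : S) (p : P2) : Set P2 :=
  {q | ∑ i, eval p.rep (pderiv i F) * q.rep i = 0}

/-- For `p ≠ q`: the intersection multiplicity at `p` of the curve `F = 0` with the line through
`p` and `q`, that is, the order of vanishing at `t = 0` of the restriction `F (p + t q)` of `F` to
this line. It is `⊤` exactly when the line is contained in the curve. -/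
def lineIntersectionMultiplicity (F : S) (p q : P2) : ℕ∞ :=
  emultiplicity (Polynomial.X : Polynomial ℂ)
    (aeval (fun i => Polynomial.C (p.rep i) + Polynomial.C (q.rep i) * Polynomial.X) F)

/-- `p` is an inflection point of `F = 0`: it is a smooth point, and the intersection multiplicity
at `p` of the curve with its tangent line at `p` is greater than `2`. (The multiplicity
does not depend on the auxiliary point `q ≠ p` on the tangent line.) -/
def IsInflectionPoint (F : S) (p : P2) : Prop :=
  IsSmoothPoint F p ∧
    ∃ q ∈ tangentLine F p, q ≠ p ∧ 2 < lineIntersectionMultiplicity F p q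

/-- The set of inflectional tangents of `F = 0`: the tangent lines at the inflection points. -/
def inflectionalTangents (F : S) : Set (Set P2) :=
  {L | ∃ p, IsInflectionPoint F p ∧ L = tangentLine F p}

/-! ### Free curves -/

/-- The `S`-module `D₀(F)` of the `ℂ`-linear derivations of `S` that kill `F`. -/
def D0 (F : S) : Submodule S (Derivation ℂ S S) where
  carrier := {δ | δ F = 0}
  add_mem' := by
    intro a b ha hb
    simp only [Set.mem_ofPred_eq] at ha hb ⊢
    simp [ha, hb]
  zero_mem' := by simp
  smul_mem' := by
    intro c a ha
    simp only [Set.mem_ofPred_eq] at ha ⊢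
    simp [ha]

/-- The derivation `a ∂x + b ∂y + c ∂z` is homogeneous of degree `e`: so are `a`, `b`, `c`. -/
def IsHomogeneousDerivation (δ : Derivation ℂ S S) (e : ℕ) : Prop :=
  ∀ i, (δ (X i)).IsHomogeneous e

/-- The curve `F = 0` of degree `n` is reduced and free with exponents `(d₁, d₂)`: the graded
`S`-module `D₀(F)` has a basis of two homogeneous derivations, of degrees `d₁` and `d₂`. -/
def IsFreeCurve (F : S) (n d₁ d₂ : ℕ) : Prop :=
  IsReducedCurve F n ∧
    ∃ b : Module.Basis (Fin 2) S (D0 F),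
      IsHomogeneousDerivation (b 0 : Derivation ℂ S S) d₁ ∧
      IsHomogeneousDerivation (b 1 : Derivation ℂ S S) d₂

/-! ### Local equations, Tjurina numbers, ADE singularities -/

/-- The index `i` of a standard affine chart `x_i = 1` that contains `p`. -/
def chartIndex (p : P2) : Fin 3 :=
  if p.rep 2 ≠ 0 then 2 else if p.rep 1 ≠ 0 then 1 else 0

/-- The two affine coordinates of `p` in the chart `chartIndex p`. -/
def localCoord (p : P2) : Fin 2 → ℂ :=
  fun j => p.rep ((chartIndex p).succAbove j) / p.rep (chartIndex p)

/-- The affine equation of the curve `F = 0` in the chart `chartIndex p`: the variable `x_i` with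
`i = chartIndex p` is replaced by `1`. -/
def localEquation (F : S) (p : P2) : MvPolynomial (Fin 2) ℂ :=
  aeval (Fin.insertNth (α := fun _ => MvPolynomial (Fin 2) ℂ) (chartIndex p) 1 X) F

/-- The maximal ideal of `ℂ[u, v]` of the point `w`. -/
def pointIdeal (w : Fin 2 → ℂ) : Ideal (MvPolynomial (Fin 2) ℂ) :=
  RingHom.ker (eval w)

instance (w : Fin 2 → ℂ) : (pointIdeal w).IsPrime :=
  RingHom.ker_isPrime (eval w)

/-- The local ring of the affine plane at the point `w`. -/
abbrev LocalRingAt (w : Fin 2 → ℂ) : Type := Localization.AtPrime (pointIdeal w)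

/-- The Tjurina ideal `(f, f_u, f_v)` in the local ring at `w`. -/
def tjurinaIdeal (f : MvPolynomial (Fin 2) ℂ) (w : Fin 2 → ℂ) : Ideal (LocalRingAt w) :=
  (Ideal.span {f, pderiv 0 f, pderiv 1 f}).map (algebraMap (MvPolynomial (Fin 2) ℂ) (LocalRingAt w))

/-- The local Tjurina number of the plane curve `F = 0` at `p` (it is `0` unless `p` is a singular
point of the curve). -/
def tjurinaNumberAt (F : S) (p : P2) : ℕ :=
  Module.finrank ℂ (LocalRingAt (localCoord p) ⧸ tjurinaIdeal (localEquation F p) (localCoord p))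

/-- The total Tjurina number of a reduced plane curve `F = 0`. -/
def totalTjurinaNumber (F : S) : ℕ :=
  ∑ᶠ p ∈ {p : P2 | IsSingularPoint F p}, tjurinaNumberAt F p

/-- The normal forms of the simple (ADE) plane curve singularities. -/
inductive IsADENormalForm : MvPolynomial (Fin 2) ℂ → Prop
  | A (k : ℕ) (hk : 1 ≤ k) : IsADENormalForm (X 0 ^ 2 + X 1 ^ (k + 1))
  | D (k : ℕ) (hk : 4 ≤ k) : IsADENormalForm (X 0 ^ 2 * X 1 + X 1 ^ (k - 1))
  | E6 : IsADENormalForm (X 0 ^ 3 + X 1 ^ 4)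
  | E7 : IsADENormalForm (X 0 ^ 3 + X 0 * X 1 ^ 3)
  | E8 : IsADENormalForm (X 0 ^ 3 + X 1 ^ 5)

/-- The germ at `w` of the curve `f = 0` is isomorphic to the germ at the origin of `g = 0`: up to
multiplication by an invertible analytic germ, `f` is the pull-back of `g` by a germ
`φ : (ℂ², w) → (ℂ², 0)` of a biholomorphic map. -/
def GermEquivalent (f : MvPolynomial (Fin 2) ℂ) (w : Fin 2 → ℂ) (g : MvPolynomial (Fin 2) ℂ) :
    Prop :=
  ∃ (φ : (Fin 2 → ℂ) → (Fin 2 → ℂ)) (φ' : (Fin 2 → ℂ) ≃L[ℂ] (Fin 2 → ℂ)) (u : (Fin 2 → ℂ) → ℂ),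
    AnalyticAt ℂ φ w ∧ φ w = 0 ∧ HasFDerivAt φ (φ' : (Fin 2 → ℂ) →L[ℂ] (Fin 2 → ℂ)) w ∧
    AnalyticAt ℂ u w ∧ u w ≠ 0 ∧
    ∀ᶠ q in 𝓝 w, eval q f = u q * eval (φ q) g

/-- The curve `F = 0` has an ADE singularity at `p`. -/
def IsADESingularity (F : S) (p : P2) : Prop :=
  ∃ g, IsADENormalForm g ∧ GermEquivalent (localEquation F p) (localCoord p) g

/-- The reduced curve `F = 0` of degree `n` is maximizing. -/
def IsMaximizing (F : S) (n : ℕ) : Prop :=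
  IsReducedCurve F n ∧
    (∀ p, IsSingularPoint F p → IsADESingularity F p) ∧
    ((∃ m : ℕ, n = 2 * m ∧ totalTjurinaNumber F = 3 * m * (m - 1) + 1) ∨
      (∃ m : ℕ, n = 2 * m + 1 ∧ totalTjurinaNumber F = 3 * m ^ 2 + 1))

/-! ### The curves built from the Fermat curve -/

/-- The Fermat polynomial `x^d + y^d + z^d`. -/
def fermat (d : ℕ) : S := X 0 ^ d + X 1 ^ d + X 2 ^ d

/-- `(x^d + y^d)(y^d + z^d)(x^d + z^d)`. -/
def arrangementA (d : ℕ) : S :=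
  (X 0 ^ d + X 1 ^ d) * (X 1 ^ d + X 2 ^ d) * (X 0 ^ d + X 2 ^ d)

/-- `xyz (x^d + y^d)(y^d + z^d)(x^d + z^d)(x^d + y^d + z^d)`. -/
def curveC' (d : ℕ) : S := X 0 * X 1 * X 2 * arrangementA d * fermat d

/-- `xy (y^d + z^d)(x^d + z^d)(x^d + y^d + z^d)`. -/
def curveC'' (d : ℕ) : S :=
  X 0 * X 1 * (X 1 ^ d + X 2 ^ d) * (X 0 ^ d + X 2 ^ d) * fermat d

end PlaneCurve

end

namespace PlaneCurve

/-! ### Divisibility in polynomial rings -/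

section Divisibility

variable {σ : Type*}

/-! Write u, v, w for x^d, y^d, z^d and E for the Euler derivation, so that E F = n F for a form F
of degree n.

Freeness rests on Saito's criterion, `isFreeCurve_of_det_eq`. If two derivations kill a squarefree
form F, their cross product is proportional to grad F; as the partials have no common factor, it is
a polynomial multiple of grad F. Pairing with E turns the determinant hypothesis into the statement
that this multiple is a nonzero constant, and Cramer's rule then expands every element of D₀(F) in
the two derivations with polynomial coefficients. The derivations themselves come from fields θ that
preserve each component: if θ F = g F, then n θ - g E kills F, and the determinant with E only picks
up a factor n for each field. Squarefreeness and coprimality of the components are read off from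
degrees in the separate variables.

For the inflections, the first three coefficients of the Fermat form on the line p + t q are, up to
binomial factors, the values on (p, p), (p, q), (q, q) of the bilinear form with diagonal entries
p_i^(d-2). If no coordinate of p vanishes, this form is nondegenerate in three variables and has no
isotropic plane, so p is not an inflection point. If p_i = 0, the line joining p to the i-th
coordinate point meets the curve at p with multiplicity d. The inflection points thus lie on the
axes, and the tangents there are the lines x_{i+1} = ζ x_{i+2} with ζ^d = -1.

For d = 2 the octic is x(x² + z²) · y(y² + z²) · (x² + y² + z²). Its singular points are the nine
points of the grid {0, i, -i}² in the chart z = 1 and the two points (1:0:0), (0:1:0). They are five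
A₁, four D₆ and two D₄, so τ = 5 + 24 + 8 = 37 = 3·4·3 + 1. Each local Tjurina number is an
intersection multiplicity, computed by additivity (`intersectionRank_mul`) after `tjurinaIdeal_eq`
has reduced the Tjurina ideal to a Jacobian ideal in suitable local coordinates. -/

lemma degreeOf_le_of_dvd {p q : MvPolynomial σ ℂ} (i : σ) (hq : q ≠ 0) (h : p ∣ q) :
    degreeOf i p ≤ degreeOf i q := by
  obtain ⟨r, rfl⟩ := h
  rw [degreeOf_mul_eq (left_ne_zero_of_mul hq) (right_ne_zero_of_mul hq)]
  exact Nat.le_add_right _ _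

lemma isUnit_of_degreeOf_eq_zero {p : MvPolynomial σ ℂ} (hp : p ≠ 0) (h : ∀ i, degreeOf i p = 0) :
    IsUnit p := by
  have h0 : p.totalDegree = 0 := by
    rw [totalDegree_eq_zero_iff]
    intro m hm i
    exact Nat.le_zero.mp ((h i) ▸ monomial_le_degreeOf i hm)
  rw [totalDegree_eq_zero_iff_eq_C] at h0
  rw [h0]
  refine IsUnit.map C (isUnit_iff_ne_zero.mpr fun hc => hp ?_)
  rw [h0, hc, map_zero]

/-- In characteristic zero a polynomial dividing its partial derivatives is constant. -/
lemma isUnit_of_forall_dvd_pderiv {p : MvPolynomial σ ℂ} (hp : p ≠ 0) (h : ∀ i, p ∣ pderiv i p) :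
    IsUnit p := by
  classical
  refine isUnit_of_degreeOf_eq_zero hp fun i => ?_
  by_contra hi
  obtain ⟨m, hm, hmi⟩ : ∃ m ∈ p.support, m i = degreeOf i p := by
    rw [degreeOf_eq_sup]
    obtain ⟨m, hm, h⟩ := Finset.exists_mem_eq_sup p.support
      (MvPolynomial.support_nonempty.mpr hp) (fun m => m i)
    exact ⟨m, hm, h.symm⟩
  -- The coefficient at a monomial of top degree in the variable i survives differentiation: it is
  -- multiplied by that positive degree.
  have hne : pderiv i p ≠ 0 := by
    intro h0
    have := congrArg (coeff (m - Finsupp.single i 1)) h0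
    rw [coeff_pderiv, tsub_add_cancel_of_le (by simp; omega), coeff_zero] at this
    rcases mul_eq_zero.mp this with h1 | h1
    · exact (mem_support_iff.mp hm) h1
    · exact Nat.cast_add_one_ne_zero _ h1
  have h1 := degreeOf_le_of_dvd i hne (h i)
  have h2 : degreeOf i (pderiv i p) < degreeOf i p := by
    rw [degreeOf_lt_iff (Nat.pos_of_ne_zero hi)]
    intro k hk
    rw [mem_support_iff, coeff_pderiv] at hk
    have := monomial_le_degreeOf i (mem_support_iff.mpr (left_ne_zero_of_mul hk))
    simp at this
    omega
  omega

variable [Fintype σ]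

/-- The partial derivatives of a squarefree homogeneous polynomial have no common factor. -/
lemma isUnit_of_dvd_pderiv {F : MvPolynomial σ ℂ} {n : ℕ} (hn : n ≠ 0) (hF : F.IsHomogeneous n)
    (hsq : Squarefree F) {p : MvPolynomial σ ℂ} (h : ∀ i, p ∣ pderiv i F) : IsUnit p := by
  have hpF : p ∣ F := by
    have h1 : p ∣ n • F := by
      rw [← hF.sum_X_mul_pderiv]
      exact Finset.dvd_sum fun i _ => (h i).mul_left _
    rw [nsmul_eq_mul] at h1
    have hu : IsUnit ((n : ℕ) : MvPolynomial σ ℂ) := by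
      rw [← map_natCast (C : ℂ →+* MvPolynomial σ ℂ)]
      exact IsUnit.map C (isUnit_iff_ne_zero.mpr (Nat.cast_ne_zero.mpr hn))
    exact (hu.dvd_mul_left).mp h1
  by_contra hu
  obtain ⟨q, hq, hqp⟩ := WfDvdMonoid.exists_irreducible_factor hu
    (ne_zero_of_dvd_ne_zero hsq.ne_zero hpF)
  obtain ⟨r, rfl⟩ := hqp.trans hpF
  have hqr : ¬ q ∣ r := by
    rintro ⟨s, rfl⟩
    exact hq.not_isUnit (hsq q ⟨s, by ring⟩)
  refine hq.not_isUnit (isUnit_of_forall_dvd_pderiv hq.ne_zero fun i => ?_)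
  have h1 := hqp.trans (h i)
  rw [pderiv_mul] at h1
  have h2 := (dvd_add_left (dvd_mul_right q _)).mp h1
  exact (hq.prime.dvd_or_dvd h2).resolve_right hqr

/-- The gcd of the products b * c i is b times the gcd of the c i, and the latter is a unit. -/
lemma dvd_of_forall_dvd_mul {ι R : Type*} [Fintype ι] [CommRing R] [IsDomain R]
    [UniqueFactorizationMonoid R] {a b : R} {c : ι → R}
    (hc : ∀ p, (∀ i, p ∣ c i) → IsUnit p) (h : ∀ i, a ∣ b * c i) : a ∣ b := by
  classical
  let _ : NormalizationMonoid R := 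
    UniqueFactorizationMonoid.strongNormalizationMonoid.toNormalizationMonoid
  let _ := UniqueFactorizationMonoid.toNormalizedGCDMonoid R
  have h1 : a ∣ Finset.univ.gcd fun i => b * c i := Finset.dvd_gcd fun i _ => h i
  have hu : IsUnit (Finset.univ.gcd c) := hc _ fun i => Finset.gcd_dvd (Finset.mem_univ i)
  exact (hu.dvd_mul_right).mp (h1.trans (Finset.gcd_mul_left' _ _ b).dvd)

end Divisibility

/-! ### Saito's criterion -/

section Saito

open Matrix

lemma derivation_apply_eq_sum (δ : Derivation ℂ S S) (F : S) :
    δ F = ∑ i, δ (X i) * pderiv i F := by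
  have h : δ = ∑ i, δ (X i) • pderiv (R := ℂ) i := by
    refine derivation_ext fun i => ?_
    fin_cases i <;> simp [Fin.sum_univ_three, pderiv_X]
  conv_lhs => rw [h]
  simp [Fin.sum_univ_three]

/-- Cramer's rule: the expansion of det(w, u, v) · I along w, u and v. When the determinant
vanishes, it writes w as a combination of u and v after multiplication by a component of u × v. -/
lemma mul_crossProduct_sub {R : Type*} [CommRing R] (u v w : Fin 3 → R) (i j : Fin 3) :
    w i * (u ⨯₃ v) j - u i * (w ⨯₃ v) j - v i * (u ⨯₃ w) j =
      if i = j then w ⬝ᵥ (u ⨯₃ v) else 0 := by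
  fin_cases i <;> fin_cases j <;> simp [cross_apply, dotProduct, Fin.sum_univ_three] <;> ring

/-- This is (u × v) × f = (u · f) v - (v · f) u = 0, in coordinates. -/
lemma crossProduct_mul_eq_of_dotProduct_eq_zero {R : Type*} [CommRing R] {u v f : Fin 3 → R}
    (hu : u ⬝ᵥ f = 0) (hv : v ⬝ᵥ f = 0) (i j : Fin 3) :
    (u ⨯₃ v) i * f j = (u ⨯₃ v) j * f i := by
  simp only [dotProduct, Fin.sum_univ_three] at hu hv
  fin_cases i <;> fin_cases j <;> simp [cross_apply] <;> grind

lemma mul_crossProduct_eq_zero {R : Type*} [CommRing R] {a b : R} {u v : Fin 3 → R}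
    (h : ∀ i, a * u i + b * v i = 0) (j : Fin 3) :
    a * (u ⨯₃ v) j = 0 ∧ b * (u ⨯₃ v) j = 0 := by
  have h0 := h 0
  have h1 := h 1
  have h2 := h 2
  clear h
  rw [cross_apply]
  fin_cases j <;> dsimp <;> constructor <;> grind

lemma exists_basis_fin_two {R M : Type*} [CommRing R] [AddCommGroup M] [Module R M] {x y : M}
    (hli : ∀ a b : R, a • x + b • y = 0 → a = 0 ∧ b = 0)
    (hsp : ∀ m, ∃ a b : R, m = a • x + b • y) :
    ∃ b : Module.Basis (Fin 2) R M, b 0 = x ∧ b 1 = y := by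
  refine ⟨Module.Basis.mk (v := ![x, y]) (LinearIndependent.pair_iff.mpr hli) ?_, ?_, ?_⟩
  · rintro m -
    obtain ⟨a, b, rfl⟩ := hsp m
    exact add_mem (Submodule.smul_mem _ _ (Submodule.subset_span ⟨0, rfl⟩))
      (Submodule.smul_mem _ _ (Submodule.subset_span ⟨1, rfl⟩))
  · simp
  · simp

variable {F : S} {n : ℕ}

/-- A vector field proportional to the gradient of a squarefree homogeneous polynomial is a
polynomial multiple of it. -/
lemma exists_eq_mul_pderiv (hn : n ≠ 0) (hF : F.IsHomogeneous n) (hsq : Squarefree F)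
    {j : Fin 3} (hj : pderiv j F ≠ 0) {a : Fin 3 → S}
    (ha : ∀ i j, a i * pderiv j F = a j * pderiv i F) :
    ∃ h, ∀ i, a i = h * pderiv i F := by
  -- For this fixed j, ∂_j F divides a_j ∂_i F for every i, and the ∂_i F have no common factor.
  have hdvd : pderiv j F ∣ a j :=
    dvd_of_forall_dvd_mul (c := fun i => pderiv i F)
      (fun p hp => isUnit_of_dvd_pderiv hn hF hsq hp) fun i => ⟨a i, by rw [ha j i]; ring⟩
  obtain ⟨h, hh⟩ := hdvd
  refine ⟨h, fun i => mul_right_cancel₀ hj ?_⟩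
  rw [ha i j, hh]; ring

/-- Saito's criterion: two derivations killing a squarefree homogeneous polynomial `F`, whose
determinant together with the Euler derivation is a nonzero constant multiple of `F`, are a basis
of `D₀(F)`. -/
theorem isFreeCurve_of_det_eq (hn : n ≠ 0) (hF : F.IsHomogeneous n) (hsq : Squarefree F)
    {δ₁ δ₂ : Derivation ℂ S S} (h₁ : δ₁ F = 0) (h₂ : δ₂ F = 0) {d₁ d₂ : ℕ}
    (hd₁ : IsHomogeneousDerivation δ₁ d₁) (hd₂ : IsHomogeneousDerivation δ₂ d₂) {c : ℂ}
    (hc : c ≠ 0)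
    (hdet : (fun i => (X i : S)) ⬝ᵥ ((fun i => δ₁ (X i)) ⨯₃ (fun i => δ₂ (X i))) = C c * F) :
    IsFreeCurve F n d₁ d₂ := by
  have euler := hF.sum_X_mul_pderiv
  have hn' : (n : ℂ) ≠ 0 := Nat.cast_ne_zero.mpr hn
  obtain ⟨j, hj⟩ : ∃ j, pderiv j F ≠ 0 := by
    by_contra! h0
    simp only [h0, mul_zero, Finset.sum_const_zero, nsmul_eq_mul] at euler
    rcases mul_eq_zero.mp euler.symm with h | h
    · exact hn (by exact_mod_cast h)
    · exact hsq.ne_zero h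
  have perp : ∀ δ : Derivation ℂ S S, δ F = 0 →
      (fun i => δ (X i)) ⬝ᵥ (fun i => pderiv i F) = 0 := fun δ h => by
    rw [← h, derivation_apply_eq_sum δ F]; rfl
  have cross : ∀ δ ε : Derivation ℂ S S, δ F = 0 → ε F = 0 →
      ∃ h, ∀ i, ((fun i => δ (X i)) ⨯₃ (fun i => ε (X i))) i = h * pderiv i F := fun δ ε hδ hε =>
    exists_eq_mul_pderiv hn hF hsq hj fun i j =>
      crossProduct_mul_eq_of_dotProduct_eq_zero (perp δ hδ) (perp ε hε) i j
  obtain ⟨h₀, hh₀⟩ := cross δ₁ δ₂ h₁ h₂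
  have h₀eq : h₀ = C (c / n) := by
    -- Pairing δ₁ × δ₂ = h₀ grad F with the Euler field gives h₀ · nF on one side and the
    -- determinant cF on the other.
    have h1 : h₀ * (n • F) = C c * F := by
      rw [← euler, ← hdet, Finset.mul_sum]
      exact Finset.sum_congr rfl fun i _ => by rw [hh₀]; ring
    have h2 : (C (n : ℂ) : S) ≠ 0 := by simpa using hn
    have h3 : h₀ * C (n : ℂ) = C c := by
      refine mul_right_cancel₀ hsq.ne_zero ?_
      rw [← h1, nsmul_eq_mul, map_natCast]; ring
    refine mul_right_cancel₀ h2 ?_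
    rw [h3, ← C_mul, div_mul_cancel₀ _ hn']
  have key : ∀ a b : S, a • δ₁ + b • δ₂ = 0 → a = 0 ∧ b = 0 := by
    intro a b hab
    have hX : ∀ i, a * δ₁ (X i) + b * δ₂ (X i) = 0 := fun i => by
      have := congrArg (fun δ : Derivation ℂ S S => δ (X i)) hab
      simpa using this
    have hjj : h₀ * pderiv j F ≠ 0 := by
      rw [h₀eq]
      refine mul_ne_zero ?_ hj
      simpa using ⟨hc, hn⟩
    have hA : a * (h₀ * pderiv j F) = 0 := by
      rw [← hh₀]
      exact (mul_crossProduct_eq_zero (u := fun i => δ₁ (X i)) (v := fun i => δ₂ (X i)) hX j).1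
    have hB : b * (h₀ * pderiv j F) = 0 := by
      rw [← hh₀]
      exact (mul_crossProduct_eq_zero (u := fun i => δ₁ (X i)) (v := fun i => δ₂ (X i)) hX j).2
    exact ⟨(mul_eq_zero.mp hA).resolve_right hjj, (mul_eq_zero.mp hB).resolve_right hjj⟩
  have hsp : ∀ δ : D0 F, ∃ a b : S, δ = a • ⟨δ₁, h₁⟩ + b • ⟨δ₂, h₂⟩ := by
    rintro ⟨δ, hδ⟩
    obtain ⟨k₁, hk₁⟩ := cross δ δ₂ hδ h₂
    obtain ⟨k₂, hk₂⟩ := cross δ₁ δ h₁ hδ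
    -- All three cross products in Cramer's rule are multiples of grad F, and det(δ, δ₁, δ₂) = h₀ (δ
    -- · grad F) = 0. Comparing j-th components allows cancelling ∂_j F; the constant h₀ is then
    -- inverted.
    have hmul : ∀ i, h₀ * δ (X i) = k₁ * δ₁ (X i) + k₂ * δ₂ (X i) := by
      intro i
      have h1 := mul_crossProduct_sub (fun i => δ₁ (X i)) (fun i => δ₂ (X i))
        (fun i => δ (X i)) i j
      have h2 : (fun i => δ (X i)) ⬝ᵥ ((fun i => δ₁ (X i)) ⨯₃ (fun i => δ₂ (X i))) = 0 := by
        rw [show ((fun i => δ₁ (X i)) ⨯₃ (fun i => δ₂ (X i))) = h₀ • (fun i => pderiv i F) from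
          funext fun i => hh₀ i, dotProduct_smul, perp δ hδ, smul_zero]
      rw [h2, ite_self, hh₀, hk₁, hk₂] at h1
      refine mul_right_cancel₀ hj ?_
      linear_combination h1
    have hinv : C (n / c) * h₀ = (1 : S) := by
      rw [h₀eq, ← C_mul, div_mul_div_comm, mul_comm c, div_self (mul_ne_zero hn' hc), C_1]
    refine ⟨C (n / c) * k₁, C (n / c) * k₂, Subtype.ext (derivation_ext fun i => ?_)⟩
    have := hmul i
    simp only [Submodule.coe_add, Submodule.coe_smul, Derivation.add_apply,
      Derivation.smul_apply, smul_eq_mul]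
    linear_combination (-δ (X i)) * hinv + C (n / c) * this
  obtain ⟨b, hb₀, hb₁⟩ := exists_basis_fin_two (x := (⟨δ₁, h₁⟩ : D0 F)) (y := (⟨δ₂, h₂⟩ : D0 F))
    (fun a b hab => key a b (by simpa using congrArg Subtype.val hab)) hsp
  exact ⟨⟨hF, hsq⟩, b, by rwa [hb₀], by rwa [hb₁]⟩

end Saito

/-! ### The curves `C'` and `C''` are reduced -/

section Reduced

open Matrix

/-- The polynomial `a₀ x^d + a₁ y^d + a₂ z^d`. -/
noncomputable def diagonalForm (d : ℕ) (a : Fin 3 → ℂ) : S := ∑ i, C (a i) * X i ^ d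

lemma coeff_diagonalForm {d : ℕ} (hd : d ≠ 0) (a : Fin 3 → ℂ) (j : Fin 3) :
    coeff (Finsupp.single j d) (diagonalForm d a) = a j := by
  simp only [diagonalForm, coeff_sum, coeff_C_mul, coeff_X_pow]
  rw [Finset.sum_eq_single j]
  · simp
  · intro i _ hij
    rw [if_neg, mul_zero]
    rw [Finsupp.single_left_inj hd]
    exact hij
  · simp

lemma diagonalForm_ne_zero {d : ℕ} (hd : d ≠ 0) {a : Fin 3 → ℂ} (ha : a ≠ 0) :
    diagonalForm d a ≠ 0 := by
  obtain ⟨j, hj⟩ := Function.ne_iff.mp ha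
  intro h
  have := coeff_diagonalForm hd a j
  rw [h, coeff_zero] at this
  exact hj this.symm

lemma degreeOf_diagonalForm_eq_zero (d : ℕ) {a : Fin 3 → ℂ} {j : Fin 3} (ha : a j = 0) :
    degreeOf j (diagonalForm d a) = 0 := by
  refine Nat.le_zero.mp ((degreeOf_sum_le j _ _).trans (Finset.sup_le fun i _ => ?_))
  by_cases hij : i = j
  · simp [hij, ha]
  · refine (degreeOf_C_mul_le _ _ _).trans ((degreeOf_pow_le _ _ _).trans ?_)
    rw [degreeOf_X_of_ne (Ne.symm hij), mul_zero]

lemma isUnit_of_dvd_diagonalForm {d : ℕ} (hd : d ≠ 0) {p : S} (a : Fin 3 → Fin 3 → ℂ)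
    (ha : ∀ i, a i ≠ 0) (hai : ∀ i, a i i = 0) (h : ∀ i, p ∣ diagonalForm d (a i)) :
    IsUnit p := by
  refine isUnit_of_degreeOf_eq_zero
    (ne_zero_of_dvd_ne_zero (diagonalForm_ne_zero hd (ha 0)) (h 0)) fun i => ?_
  have := degreeOf_le_of_dvd i (diagonalForm_ne_zero hd (ha i)) (h i)
  rwa [degreeOf_diagonalForm_eq_zero d (hai i), Nat.le_zero] at this

/-- A common divisor divides the whole pencil spanned by the two forms. For each variable the pencil
has a nonzero member free of that variable, so the divisor has degree 0 in every variable. -/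
lemma isRelPrime_diagonalForm {d : ℕ} (hd : d ≠ 0) {a b : Fin 3 → ℂ} (h : a ⨯₃ b ≠ 0) :
    IsRelPrime (diagonalForm d a) (diagonalForm d b) := by
  intro p hpa hpb
  have hcomb : ∀ s t : ℂ, p ∣ diagonalForm d (s • a + t • b) := fun s t => by
    have : diagonalForm d (s • a + t • b) = C s * diagonalForm d a + C t * diagonalForm d b := by
      simp only [diagonalForm, Finset.mul_sum, ← Finset.sum_add_distrib]
      refine Finset.sum_congr rfl fun i _ => ?_
      simp; ring
    rw [this]
    exact dvd_add (hpa.mul_left _) (hpb.mul_left _)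
  have ha : a ≠ 0 := by rintro rfl; simp at h
  have hb : b ≠ 0 := by rintro rfl; simp at h
  have hex : ∀ i, ∃ c : Fin 3 → ℂ, c ≠ 0 ∧ c i = 0 ∧ p ∣ diagonalForm d c := by
    intro i
    by_cases hi : a i = 0
    · exact ⟨a, ha, hi, hpa⟩
    refine ⟨b i • a + (-a i) • b, ?_, by simp; ring, hcomb _ _⟩
    intro h0
    apply h
    have : b = (b i / a i) • a := by
      ext j
      have := congrFun h0 j
      simp at this ⊢
      field_simp
      linear_combination -this
    rw [this]
    simp
  choose c hc0 hci hcp using hex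
  exact isUnit_of_dvd_diagonalForm hd c hc0 hci hcp

lemma pderiv_diagonalForm (d : ℕ) (a : Fin 3 → ℂ) (j : Fin 3) :
    pderiv j (diagonalForm d a) = C (d * a j) * X j ^ (d - 1) := by
  fin_cases j <;> simp [diagonalForm, Fin.sum_univ_three, pderiv_X] <;> ring

/-- A repeated factor divides the partials, hence powers of two different variables, hence is
constant. -/
lemma squarefree_diagonalForm {d : ℕ} (hd : d ≠ 0) {a : Fin 3 → ℂ} {i j : Fin 3} (hij : i ≠ j)
    (hi : a i ≠ 0) (hj : a j ≠ 0) : Squarefree (diagonalForm d a) := by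
  rintro p ⟨q, hq⟩
  have hdvd : ∀ k, a k ≠ 0 → p ∣ X k ^ (d - 1) := by
    intro k hk
    have h1 : p ∣ pderiv k (diagonalForm d a) := by
      rw [hq, pderiv_mul, pderiv_mul]
      exact ⟨pderiv k p * q + pderiv k p * q + p * pderiv k q, by ring⟩
    rw [pderiv_diagonalForm] at h1
    refine ((IsUnit.map C (isUnit_iff_ne_zero.mpr ?_)).dvd_mul_left).mp h1
    exact mul_ne_zero (Nat.cast_ne_zero.mpr hd) hk
  have hX : ∀ k, (X k : S) ^ (d - 1) ≠ 0 := fun k => pow_ne_zero _ (X_ne_zero k)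
  refine isUnit_of_degreeOf_eq_zero (ne_zero_of_dvd_ne_zero (hX i) (hdvd i hi)) fun k => ?_
  obtain ⟨l, hl, hkl⟩ : ∃ l, a l ≠ 0 ∧ k ≠ l := by
    by_cases hk : k = i
    · exact ⟨j, hj, hk ▸ hij⟩
    · exact ⟨i, hi, hk⟩
  have h1 := degreeOf_le_of_dvd k (hX l) (hdvd l hl)
  have h2 := degreeOf_pow_le k (X l : S) (d - 1)
  rw [degreeOf_X_of_ne hkl, mul_zero] at h2
  omega

variable {d : ℕ}

lemma squarefree_curveC' (hd : d ≠ 0) : Squarefree (curveC' d) := by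
  let a : Fin 7 → Fin 3 → ℂ := ![![1, 0, 0], ![0, 1, 0], ![0, 0, 1], ![1, 1, 0], ![0, 1, 1],
    ![1, 0, 1], ![1, 1, 1]]
  let f : Fin 7 → S := ![X 0, X 1, X 2, X 0 ^ d + X 1 ^ d, X 1 ^ d + X 2 ^ d, X 0 ^ d + X 2 ^ d,
    fermat d]
  have hf : curveC' d = ∏ i, f i := by
    simp [Fin.prod_univ_succ, f, curveC', arrangementA]
    ring
  -- A coordinate is not itself a diagonal form when d > 1, but it divides its d-th power, and
  -- coprimality passes to divisors. Squarefreeness does not follow this way, so the coordinates are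
  -- handled as primes below.
  have hdvd : ∀ i, f i ∣ diagonalForm d (a i) := by
    intro i
    fin_cases i <;> simp [f, a, diagonalForm, Fin.sum_univ_three, fermat, dvd_pow_self _ hd]
  have hsq : ∀ i, Squarefree (f i) := by
    have hsq' : ∀ b : Fin 3 → ℂ, ∀ i j, i ≠ j → b i ≠ 0 → b j ≠ 0 →
      Squarefree (diagonalForm d b) := fun b i j => squarefree_diagonalForm hd
    intro i
    fin_cases i
    · exact (X_prime (i := (0 : Fin 3))).squarefree
    · exact (X_prime (i := (1 : Fin 3))).squarefree
    · exact (X_prime (i := (2 : Fin 3))).squarefree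
    · simpa [f, diagonalForm, Fin.sum_univ_three] using hsq' ![1, 1, 0] 0 1
    · simpa [f, diagonalForm, Fin.sum_univ_three] using hsq' ![0, 1, 1] 1 2
    · simpa [f, diagonalForm, Fin.sum_univ_three] using hsq' ![1, 0, 1] 0 2
    · simpa [f, diagonalForm, Fin.sum_univ_three, fermat] using hsq' ![1, 1, 1] 0 1
  rw [hf]
  refine Finset.squarefree_prod_of_pairwise_isCoprime (fun i _ j _ hij => ?_) fun i _ => hsq i
  suffices h : a i ⨯₃ a j ≠ 0 from fun p hpi hpj =>
    isRelPrime_diagonalForm hd h (hpi.trans (hdvd i)) (hpj.trans (hdvd j))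
  revert hij
  fin_cases i <;> fin_cases j <;> simp [a, cross_apply]

lemma curveC''_dvd_curveC' (d : ℕ) : curveC'' d ∣ curveC' d :=
  ⟨X 2 * (X 0 ^ d + X 1 ^ d), by simp only [curveC', curveC'', arrangementA]; ring⟩

lemma squarefree_curveC'' (hd : d ≠ 0) : Squarefree (curveC'' d) :=
  (squarefree_curveC' hd).squarefree_of_dvd (curveC''_dvd_curveC' d)

lemma squarefree_fermat (hd : d ≠ 0) : Squarefree (fermat d) :=
  (squarefree_curveC' hd).squarefree_of_dvd (dvd_mul_left _ _)

lemma isHomogeneous_X_pow_add (d : ℕ) (i j : Fin 3) :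
    ((X i : S) ^ d + X j ^ d).IsHomogeneous d :=
  (isHomogeneous_X_pow i d).add (isHomogeneous_X_pow j d)

lemma isHomogeneous_fermat (d : ℕ) : (fermat d).IsHomogeneous d :=
  (isHomogeneous_X_pow_add d 0 1).add (isHomogeneous_X_pow 2 d)

lemma isHomogeneous_curveC' (d : ℕ) : (curveC' d).IsHomogeneous (4 * d + 3) := by
  have h := ((((isHomogeneous_X ℂ (0 : Fin 3)).mul (isHomogeneous_X ℂ 1)).mul
    (isHomogeneous_X ℂ 2)).mul (((isHomogeneous_X_pow_add d 0 1).mul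
    (isHomogeneous_X_pow_add d 1 2)).mul (isHomogeneous_X_pow_add d 0 2))).mul
    (isHomogeneous_fermat d)
  rwa [show 1 + 1 + 1 + (d + d + d) + d = 4 * d + 3 by ring] at h

lemma isHomogeneous_curveC'' (d : ℕ) : (curveC'' d).IsHomogeneous (3 * d + 2) := by
  have h := ((((isHomogeneous_X ℂ (0 : Fin 3)).mul (isHomogeneous_X ℂ 1)).mul
    (isHomogeneous_X_pow_add d 1 2)).mul (isHomogeneous_X_pow_add d 0 2)).mul
    (isHomogeneous_fermat d)
  rwa [show 1 + 1 + d + d + d = 3 * d + 2 by ring] at h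

end Reduced

/-! ### The curves `C'` and `C''` are free -/

section Free

open Matrix

lemma derivation_X_pow {δ : Derivation ℂ S S} {i : Fin 3} {a : S} (h : δ (X i) = a * X i) (d : ℕ) :
    δ (X i ^ d) = (d : S) * a * X i ^ d := by
  rw [Derivation.leibniz_pow, h]
  rcases d with _ | d
  · simp
  · simp [pow_succ]; ring

lemma isHomogeneous_natCast (n : ℕ) : (n : S).IsHomogeneous 0 := by
  rw [← map_natCast (C : ℂ →+* S)]
  exact isHomogeneous_C _ _

/-- The coefficient `(w - v) ((v + w) + d (u + 3 v + 3 w))`, with `u`, `v`, `w` the `d`-th powers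
of the variables of index `i`, `j`, `k`. -/
noncomputable def curveC'Coeff (d : ℕ) (i j k : Fin 3) : S :=
  (X k ^ d - X j ^ d) * ((X j ^ d + X k ^ d) + (d : S) * ((X i ^ d + X j ^ d) + X k ^ d +
    ((2 : ℕ) : S) * (X j ^ d + X k ^ d)))

/-- The coefficient `(4 d + 3) (u + v) (v + w)`, with `u`, `v`, `w` the `d`-th powers of the
variables of index `i`, `j`, `k`. -/
noncomputable def curveC'Diff (d : ℕ) (i j k : Fin 3) : S :=
  ((4 * d + 3 : ℕ) : S) * ((X i ^ d + X j ^ d) * (X j ^ d + X k ^ d))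

lemma isHomogeneous_curveC'Coeff (d : ℕ) (i j k : Fin 3) :
    (curveC'Coeff d i j k).IsHomogeneous (2 * d) := by
  have hs := isHomogeneous_X_pow_add d
  have h := ((isHomogeneous_X_pow (R := ℂ) k d).sub (isHomogeneous_X_pow j d)).mul
    ((hs j k).add <| ((zero_add d) ▸ (isHomogeneous_natCast d).mul (((hs i j).add
      (isHomogeneous_X_pow k d)).add ((zero_add d) ▸ (isHomogeneous_natCast 2).mul (hs j k)))))
  rw [← two_mul] at h
  exact h

lemma isHomogeneous_curveC'Diff (d : ℕ) (i j k : Fin 3) :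
    (curveC'Diff d i j k).IsHomogeneous (2 * d) := by
  have hs := isHomogeneous_X_pow_add d
  have h := (isHomogeneous_natCast (4 * d + 3)).mul ((hs i j).mul (hs j k))
  rw [← two_mul, zero_add] at h
  exact h

variable {d : ℕ}

/-- The field θ = (u+v)(v+w) y∂y - (u+w)(v+w) z∂z preserves every component: on x^d + y^d + z^d this
works because v(u+v) - w(u+w) = (v-w)(u+v+w). Here θF = -g F with g = `curveC'Coeff d 0 1 2`, so
(4d+3) θ + g E kills F. The second derivation is the image of the first under the cyclic shift of
the variables. -/
theorem isFreeCurve_curveC' (hd : d ≠ 0) :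
    IsFreeCurve (curveC' d) (4 * d + 3) (2 * d + 1) (2 * d + 1) := by
  let a : Fin 3 → S := ![curveC'Coeff d 0 1 2, curveC'Coeff d 0 1 2 + curveC'Diff d 0 1 2,
    curveC'Coeff d 0 1 2 - curveC'Diff d 0 2 1]
  let b : Fin 3 → S := ![curveC'Coeff d 1 2 0 - curveC'Diff d 1 0 2, curveC'Coeff d 1 2 0,
    curveC'Coeff d 1 2 0 + curveC'Diff d 1 2 0]
  let δ₁ : Derivation ℂ S S := mkDerivation ℂ fun i => a i * X i
  let δ₂ : Derivation ℂ S S := mkDerivation ℂ fun i => b i * X i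
  have h₁ : ∀ i, δ₁ (X i) = a i * X i := mkDerivation_X ℂ _
  have h₂ : ∀ i, δ₂ (X i) = b i * X i := mkDerivation_X ℂ _
  have hkill : ∀ (δ : Derivation ℂ S S) (c : Fin 3 → S), (∀ i, δ (X i) = c i * X i) →
      (c = a ∨ c = b) → δ (curveC' d) = 0 := by
    intro δ c hδ hc
    have hp := fun i => derivation_X_pow (hδ i) d
    simp only [curveC', arrangementA, fermat, Derivation.leibniz, map_add, hδ, hp, smul_eq_mul]
    rcases hc with rfl | rfl
    · simp only [a, curveC'Coeff, curveC'Diff, Matrix.cons_val]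
      push_cast
      ring
    · simp only [b, curveC'Coeff, curveC'Diff, Matrix.cons_val]
      push_cast
      ring
  refine isFreeCurve_of_det_eq (by omega) (isHomogeneous_curveC' d) (squarefree_curveC' hd)
    (hkill δ₁ a h₁ (.inl rfl)) (hkill δ₂ b h₂ (.inr rfl)) ?_ ?_
    -- Multiples of E drop out of the determinant. What remains is (4d+3)² xyz (u+v)(v+w)(u+w) times
    -- (u+v) + (v+w) + (u+w) = 2(u+v+w).
    (c := 2 * (4 * d + 3) ^ 2) (by norm_cast; simp) ?_
  · intro i
    rw [h₁]
    refine IsHomogeneous.mul ?_ (isHomogeneous_X _ _)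
    have hc := isHomogeneous_curveC'Coeff d
    have hD := isHomogeneous_curveC'Diff d
    fin_cases i
    · exact hc _ _ _
    · exact (hc _ _ _).add (hD _ _ _)
    · exact (hc _ _ _).sub (hD _ _ _)
  · intro i
    rw [h₂]
    refine IsHomogeneous.mul ?_ (isHomogeneous_X _ _)
    have hc := isHomogeneous_curveC'Coeff d
    have hD := isHomogeneous_curveC'Diff d
    fin_cases i
    · exact (hc _ _ _).sub (hD _ _ _)
    · exact hc _ _ _
    · exact (hc _ _ _).add (hD _ _ _)
  · simp only [h₁, h₂, cross_apply, dotProduct, Fin.sum_univ_three]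
    simp only [a, b, curveC'Coeff, curveC'Diff, curveC', arrangementA, fermat, Matrix.cons_val,
      C_mul, C_pow, C_add, map_natCast, map_ofNat]
    push_cast
    ring

/-- Two fields preserve F. The first, (v+w) x∂x - (u+w) y∂y + (v-u) z∂z, kills the Fermat form. The
second is (v+w) x times the Koszul field x^(d-1) ∂z - z^(d-1) ∂x, which kills both u+w and u+v+w;
the line z = 0 is not a component, so it need not be preserved. The multiples `γ₁` and `γ₂ z^(d-1)`
of E correct 3d+2 times these fields to kill F. -/
theorem isFreeCurve_curveC'' (hd : d ≠ 0) :
    IsFreeCurve (curveC'' d) (3 * d + 2) (d + 1) (2 * d) := by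
  -- The second derivation contains z^(d-1), written z^e to avoid truncated subtraction.
  obtain ⟨e, rfl⟩ := Nat.exists_eq_succ_of_ne_zero hd
  rw [Nat.succ_eq_add_one] at *
  set d := e + 1 with hde
  let γ₁ : S := ((d + 1 : ℕ) : S) * (X 0 ^ d - X 1 ^ d)
  let a : Fin 3 → S := ![γ₁ + ((3 * d + 2 : ℕ) : S) * (X 1 ^ d + X 2 ^ d),
    γ₁ - ((3 * d + 2 : ℕ) : S) * (X 0 ^ d + X 2 ^ d),
    γ₁ + ((3 * d + 2 : ℕ) : S) * (X 1 ^ d - X 0 ^ d)]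
  let γ₂ : S := (X 1 ^ d + X 2 ^ d) - (d : S) * X 0 ^ d
  let b : Fin 3 → S := ![(γ₂ - ((3 * d + 2 : ℕ) : S) * (X 1 ^ d + X 2 ^ d)) * (X 0 * X 2 ^ e),
    γ₂ * (X 1 * X 2 ^ e),
    γ₂ * X 2 ^ d + ((3 * d + 2 : ℕ) : S) * ((X 1 ^ d + X 2 ^ d) * X 0 ^ d)]
  let δ₁ : Derivation ℂ S S := mkDerivation ℂ fun i => a i * X i
  let δ₂ : Derivation ℂ S S := mkDerivation ℂ b
  have h₁ : ∀ i, δ₁ (X i) = a i * X i := mkDerivation_X ℂ _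
  have h₂ : ∀ i, δ₂ (X i) = b i := mkDerivation_X ℂ _
  have hk₁ : δ₁ (curveC'' d) = 0 := by
    have hp := fun i => derivation_X_pow (h₁ i) d
    simp only [curveC'', fermat, Derivation.leibniz, map_add, h₁, hp, smul_eq_mul]
    simp only [a, γ₁, Matrix.cons_val]
    push_cast
    ring
  have hk₂ : δ₂ (curveC'' d) = 0 := by
    simp only [curveC'', fermat, Derivation.leibniz, Derivation.leibniz_pow, map_add, h₂]
    simp only [b, γ₂, hde, Matrix.cons_val, add_tsub_cancel_right, nsmul_eq_mul, smul_eq_mul]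
    push_cast
    ring
  have hN := fun (n : ℕ) {p : S} {m : ℕ} (hp : p.IsHomogeneous m) =>
    (zero_add m) ▸ (isHomogeneous_natCast n).mul hp
  have hX := fun i => isHomogeneous_X_pow (R := ℂ) (i : Fin 3) d
  have hs := isHomogeneous_X_pow_add d
  have hγ₁ : γ₁.IsHomogeneous d := hN _ ((hX _).sub (hX _))
  have hγ₂ : γ₂.IsHomogeneous d := (hs _ _).sub (hN _ (hX _))
  refine isFreeCurve_of_det_eq (by omega) (isHomogeneous_curveC'' d) (squarefree_curveC'' hd)
    hk₁ hk₂ ?_ ?_ (c := -(3 * d + 2) ^ 2) (neg_ne_zero.mpr (by norm_cast; simp)) ?_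
  · intro i
    rw [h₁]
    refine IsHomogeneous.mul ?_ (isHomogeneous_X _ _)
    fin_cases i
    · exact hγ₁.add (hN _ (hs _ _))
    · exact hγ₁.sub (hN _ (hs _ _))
    · exact hγ₁.add (hN _ ((hX _).sub (hX _)))
  · intro i
    rw [h₂]
    have h2d : 2 * d = d + d := two_mul d
    have h2e : 2 * d = d + (1 + e) := by omega
    fin_cases i
    · rw [h2e]
      exact (hγ₂.sub (hN _ (hs _ _))).mul ((isHomogeneous_X _ _).mul (isHomogeneous_X_pow _ _))
    · rw [h2e]
      exact hγ₂.mul ((isHomogeneous_X _ _).mul (isHomogeneous_X_pow _ _))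
    · rw [h2d]
      exact (hγ₂.mul (hX _)).add (hN _ ((hs _ _).mul (hX _)))
  · simp only [h₁, h₂, cross_apply, dotProduct, Fin.sum_univ_three]
    simp only [a, b, γ₁, γ₂, curveC'', fermat, hde, Matrix.cons_val,
      C_neg, C_mul, C_pow, C_add, map_natCast, map_ofNat]
    push_cast
    ring

end Free

/-! ### Inflectional tangents of the Fermat curve -/

section Inflection

variable {d : ℕ}

lemma eval_fermat (d : ℕ) (v : Fin 3 → ℂ) : eval v (fermat d) = ∑ i, v i ^ d := by
  simp [fermat, Fin.sum_univ_three]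

lemma eval_pderiv_fermat (d : ℕ) (v : Fin 3 → ℂ) (i : Fin 3) :
    eval v (pderiv i (fermat d)) = d * v i ^ (d - 1) := by
  fin_cases i <;> simp [fermat, pderiv_X]

lemma not_isSingularPoint_fermat (hd : d ≠ 0) (p : P2) : ¬ IsSingularPoint (fermat d) p := by
  rintro ⟨-, h⟩
  refine p.rep_nonzero (funext fun i => ?_)
  have := h i
  rw [eval_pderiv_fermat, mul_eq_zero, Nat.cast_eq_zero, or_iff_right hd] at this
  exact eq_zero_of_pow_eq_zero this

lemma sum_fin_three_rotate {M : Type*} [AddCommMonoid M] (f : Fin 3 → M) (i : Fin 3) :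
    ∑ j, f j = f i + f (i + 1) + f (i + 2) := by
  rw [Fin.sum_univ_three]
  fin_cases i
  · rfl
  · exact (add_assoc _ _ _).trans (add_comm _ _)
  · exact (add_comm _ _).trans (add_assoc _ _ _).symm

lemma fin_three_cases {P : Fin 3 → Prop} (i : Fin 3) (h0 : P i) (h1 : P (i + 1))
    (h2 : P (i + 2)) (j : Fin 3) : P j := by
  fin_cases i <;> fin_cases j <;> assumption

lemma coeff_linear_pow (a b : ℂ) (d k : ℕ) :
    ((Polynomial.C a + Polynomial.C b * Polynomial.X) ^ d).coeff k =
      d.choose k * a ^ (d - k) * b ^ k := by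
  have h : (Polynomial.C a + Polynomial.C b * Polynomial.X) ^ d =
      ∑ m ∈ Finset.range (d + 1),
        Polynomial.C (b ^ m * a ^ (d - m) * d.choose m) * Polynomial.X ^ m := by
    rw [add_comm, add_pow]
    refine Finset.sum_congr rfl fun m _ => ?_
    simp only [mul_pow, Polynomial.C_mul, Polynomial.C_pow, map_natCast]
    ring
  rw [h, Polynomial.finsetSum_coeff]
  simp only [Polynomial.coeff_C_mul_X_pow]
  rw [Finset.sum_ite_eq]
  split_ifs with hk
  · ring
  · rw [Nat.choose_eq_zero_of_lt (by simpa using hk)]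
    simp

lemma two_lt_lineIntersectionMultiplicity_fermat (d : ℕ) (p q : P2) :
    2 < lineIntersectionMultiplicity (fermat d) p q ↔
      ∀ k < 3, (d.choose k : ℂ) * ∑ i, p.rep i ^ (d - k) * q.rep i ^ k = 0 := by
  rw [lineIntersectionMultiplicity, ← ENat.add_one_le_iff (by simp),
    show (2 : ℕ∞) + 1 = (3 : ℕ) by norm_num, ← pow_dvd_iff_le_emultiplicity,
    Polynomial.X_pow_dvd_iff]
  refine forall₂_congr fun k _ => ?_
  rw [Finset.mul_sum]
  simp [fermat, coeff_linear_pow, Fin.sum_univ_three, mul_assoc]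

lemma mem_tangentLine_fermat (hd : d ≠ 0) (p q : P2) :
    q ∈ tangentLine (fermat d) p ↔ ∑ i, p.rep i ^ (d - 1) * q.rep i = 0 := by
  simp only [tangentLine, Set.mem_ofPred_eq, eval_pderiv_fermat, mul_assoc]
  rw [← Finset.mul_sum, mul_eq_zero, Nat.cast_eq_zero, or_iff_right hd]

/-- Frees homogeneous linear conditions from the choice of representative; ζ = 0 expresses the
vanishing of a coordinate. -/
lemma mk_rep_apply_eq_mul_iff {v : Fin 3 → ℂ} (hv : v ≠ 0) (i j : Fin 3) (ζ : ℂ) :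
    (Projectivization.mk ℂ v hv).rep i = ζ * (Projectivization.mk ℂ v hv).rep j ↔
      v i = ζ * v j := by
  obtain ⟨a, ha⟩ := Projectivization.exists_smul_eq_mk_rep ℂ v hv
  rw [← ha]
  simp only [Pi.smul_apply, Units.smul_def, smul_eq_mul]
  rw [mul_left_comm, mul_right_inj' a.ne_zero]

lemma eq_of_crossed_eq {p q : P2} (h : ∀ i j, p.rep i * q.rep j = p.rep j * q.rep i) :
    p = q := by
  obtain ⟨i, hi⟩ := Function.ne_iff.mp q.rep_nonzero
  rw [← p.mk_rep, ← q.mk_rep, Projectivization.mk_eq_mk_iff']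
  refine ⟨p.rep i / q.rep i, funext fun j => ?_⟩
  have := h i j
  simp only [Pi.zero_apply, Pi.smul_apply, smul_eq_mul] at hi ⊢
  field_simp
  linear_combination this

lemma isInflectionPoint_fermat_iff (hd : 3 ≤ d) (p : P2) :
    IsInflectionPoint (fermat d) p ↔ p ∈ zeroLocus (fermat d) ∧ ∃ i, p.rep i = 0 := by
  have hd0 : d ≠ 0 := by omega
  have hch : (d.choose 2 : ℂ) ≠ 0 := Nat.cast_ne_zero.mpr (Nat.choose_pos (by omega)).ne'
  constructor
  · rintro ⟨⟨hp, -⟩, q, hq, hqp, hlt⟩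
    refine ⟨hp, ?_⟩
    by_contra! h0
    rw [two_lt_lineIntersectionMultiplicity_fermat] at hlt
    have h2 := (mul_eq_zero.mp (hlt 2 (by norm_num))).resolve_left hch
    rw [mem_tangentLine_fermat hd0] at hq
    rw [zeroLocus, Set.mem_ofPred_eq, eval_fermat] at hp
    obtain ⟨e, rfl⟩ := Nat.exists_eq_add_of_le' (show 2 ≤ d by omega)
    refine hqp (eq_of_crossed_eq ?_).symm
    have hpe : ∀ i, p.rep i ^ e ≠ 0 := fun i => pow_ne_zero _ (h0 i)
    simp only [show e + 2 - 1 = e + 1 from rfl, show e + 2 - 2 = e from rfl, pow_succ] at hp hq h2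
    have key : ∀ i, p.rep i * q.rep (i + 1) = p.rep (i + 1) * q.rep i := by
      intro i
      rw [sum_fin_three_rotate _ i] at hp hq h2
      have e0 := hpe i
      have e1 := hpe (i + 1)
      generalize p.rep i ^ e = A at *
      generalize p.rep (i + 1) ^ e = B at *
      generalize p.rep (i + 2) ^ e = D at *
      -- Lagrange's identity for the form with diagonal A, B, D. On its first two terms the Gram
      -- determinant of p and q is A B times the squared minor; as p and q span an isotropic space,
      -- it equals the Gram determinant on the third term alone, which is 0.
      have : A * B * (p.rep i * q.rep (i + 1) - p.rep (i + 1) * q.rep i) ^ 2 = 0 := by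
        linear_combination (A * q.rep i ^ 2 + B * q.rep (i + 1) ^ 2) * hp
          - D * p.rep (i + 2) ^ 2 * h2 - (A * p.rep i * q.rep i
            + B * p.rep (i + 1) * q.rep (i + 1) - D * p.rep (i + 2) * q.rep (i + 2)) * hq
      have := (mul_eq_zero.mp this).resolve_left (mul_ne_zero e0 e1)
      linear_combination pow_eq_zero_iff (two_ne_zero) |>.mp this
    intro i j
    refine fin_three_cases (P := fun j => p.rep i * q.rep j = p.rep j * q.rep i) i rfl (key i) ?_ j
    have h := key (i + 2)
    rw [show i + 2 + 1 = i by fin_cases i <;> rfl] at h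
    exact h.symm
  · rintro ⟨hp, i, hi⟩
    refine ⟨⟨hp, ?_⟩, ?_⟩
    · by_contra! h
      exact not_isSingularPoint_fermat hd0 p ⟨hp, h⟩
    -- The auxiliary point is the i-th coordinate point: mixed terms p_j^k q_j^l with k, l > 0 all
    -- vanish. The bound d ≥ 3 keeps the exponent d - k positive for k ≤ 2.
    have hv : (Pi.single i 1 : Fin 3 → ℂ) ≠ 0 := by simp
    have hrep := fun j k ζ => mk_rep_apply_eq_mul_iff hv j k ζ
    set q := Projectivization.mk ℂ _ hv with hq
    have hq0 : ∀ j, j ≠ i → q.rep j = 0 := fun j hj => by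
      have := (hrep j j 0).mpr (by simp [hj])
      simpa using this
    have hz : ∀ k l : ℕ, k ≠ 0 → l ≠ 0 → ∑ j, p.rep j ^ k * q.rep j ^ l = 0 := by
      intro k l hk hl
      refine Finset.sum_eq_zero fun j _ => ?_
      by_cases hj : j = i
      · rw [hj, hi, zero_pow hk, zero_mul]
      · rw [hq0 j hj, zero_pow hl, mul_zero]
    refine ⟨q, (mem_tangentLine_fermat hd0 p q).mpr ?_, ?_, ?_⟩
    · simpa using hz (d - 1) 1 (by omega) one_ne_zero
    · rintro h
      refine q.rep_nonzero (funext fun j => ?_)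
      by_cases hj : j = i
      · rw [hj, h, hi]; rfl
      · exact hq0 j hj
    · rw [two_lt_lineIntersectionMultiplicity_fermat]
      intro k hk
      rcases Nat.eq_zero_or_pos k with rfl | hk0
      · rw [zeroLocus, Set.mem_ofPred_eq, eval_fermat] at hp
        simpa using hp
      · rw [hz _ _ (by omega) (by omega), mul_zero]

/-- The line `x_{i+1} = ζ x_{i+2}`, with indices modulo `3`. -/
def inflectionalLine (i : Fin 3) (ζ : ℂ) : Set P2 := {q | q.rep (i + 1) = ζ * q.rep (i + 2)}

lemma tangentLine_fermat_eq (hd : d ≠ 0) {p : P2} {i : Fin 3} {ζ : ℂ} (hζ : ζ ^ d = -1)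
    (h2 : p.rep (i + 2) ≠ 0) (hi : p.rep i = 0) (hd1 : d ≠ 1)
    (h : p.rep (i + 1) = ζ * p.rep (i + 2)) :
    tangentLine (fermat d) p = inflectionalLine i ζ := by
  ext q
  have hζ0 : ζ ≠ 0 := by
    rintro rfl
    rw [zero_pow hd] at hζ
    norm_num at hζ
  rw [mem_tangentLine_fermat hd, sum_fin_three_rotate _ i, hi, h, zero_pow (by omega),
    inflectionalLine, Set.mem_ofPred_eq, zero_mul, zero_add, mul_pow]
  obtain ⟨e, rfl⟩ := Nat.exists_eq_succ_of_ne_zero hd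
  simp only [Nat.succ_eq_add_one, add_tsub_cancel_right, pow_succ] at *
  have he := pow_ne_zero e h2
  constructor
  · intro h3
    have h4 : p.rep (i + 2) ^ e * (ζ ^ e * q.rep (i + 1) + q.rep (i + 2)) = 0 := by
      linear_combination h3
    have h5 := (mul_eq_zero.mp h4).resolve_left he
    -- As ζ · ζ^(d-1) = -1, multiplying the tangent equation by -ζ solves it for x_{i+1}.
    linear_combination (-ζ) * h5 + q.rep (i + 1) * hζ
  · intro h3
    rw [h3]
    linear_combination p.rep (i + 2) ^ e * q.rep (i + 2) * hζ

lemma exists_pow_eq_neg_one (hd : d ≠ 0) : ∃ ζ : ℂ, ζ ^ d = -1 :=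
  IsAlgClosed.exists_pow_nat_eq _ (Nat.pos_of_ne_zero hd)

lemma pow_add_pow_eq_zero_iff (hd : d ≠ 0) (a b : ℂ) :
    a ^ d + b ^ d = 0 ↔ ∃ ζ : ℂ, ζ ^ d = -1 ∧ a = ζ * b := by
  constructor
  · intro h
    by_cases hb : b = 0
    · obtain ⟨ζ, hζ⟩ := exists_pow_eq_neg_one hd
      refine ⟨ζ, hζ, ?_⟩
      rw [hb, zero_pow hd, add_zero] at h
      rw [hb, mul_zero]
      exact eq_zero_of_pow_eq_zero h
    · refine ⟨a / b, ?_, by field_simp⟩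
      rw [div_pow, div_eq_iff (pow_ne_zero _ hb)]
      linear_combination h
  · rintro ⟨ζ, hζ, rfl⟩
    rw [mul_pow, hζ]; ring

lemma inflectionalTangents_fermat (hd : 3 ≤ d) :
    inflectionalTangents (fermat d) =
      (fun x : Fin 3 × ℂ => inflectionalLine x.1 x.2) '' (Set.univ ×ˢ {ζ | ζ ^ d = -1}) := by
  have hd0 : d ≠ 0 := by omega
  ext L
  simp only [inflectionalTangents, Set.mem_ofPred_eq, Set.mem_image, Set.mem_prod, Set.mem_univ,
    true_and, Prod.exists]
  constructor
  · rintro ⟨p, hp, rfl⟩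
    rw [isInflectionPoint_fermat_iff hd] at hp
    obtain ⟨hp, i, hi⟩ := hp
    rw [zeroLocus, Set.mem_ofPred_eq, eval_fermat, sum_fin_three_rotate _ i, hi, zero_pow hd0,
      zero_add, pow_add_pow_eq_zero_iff hd0] at hp
    obtain ⟨ζ, hζ, h⟩ := hp
    refine ⟨i, ζ, hζ, (tangentLine_fermat_eq hd0 hζ ?_ hi (by omega) h).symm⟩
    intro h2
    refine p.rep_nonzero (funext fun j => fin_three_cases (P := fun j => p.rep j = 0) i hi ?_ h2 j)
    rw [h, h2, mul_zero]
  · rintro ⟨i, ζ, hζ, rfl⟩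
    have hv : (Pi.single (i + 1) ζ + Pi.single (i + 2) 1 : Fin 3 → ℂ) ≠ 0 := by
      intro h
      have := congrFun h (i + 2)
      simp at this
    have hrep := fun j k ζ => mk_rep_apply_eq_mul_iff hv j k ζ
    set p := Projectivization.mk ℂ _ hv with hq
    have hi : p.rep i = 0 := by
      have := (hrep i i 0).mpr (by fin_cases i <;> simp)
      simpa using this
    have h : p.rep (i + 1) = ζ * p.rep (i + 2) :=
      (hrep _ _ _).mpr (by fin_cases i <;> simp)
    have h2 : p.rep (i + 2) ≠ 0 := by
      intro h2
      refine p.rep_nonzero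
        (funext fun j => fin_three_cases (P := fun j => p.rep j = 0) i hi ?_ h2 j)
      rw [h, h2, mul_zero]
    refine ⟨p, (isInflectionPoint_fermat_iff hd p).mpr ⟨?_, i, hi⟩,
      (tangentLine_fermat_eq hd0 hζ h2 hi (by omega) h).symm⟩
    rw [zeroLocus, Set.mem_ofPred_eq, eval_fermat, sum_fin_three_rotate _ i, hi, zero_pow hd0,
      zero_add, pow_add_pow_eq_zero_iff hd0]
    exact ⟨ζ, hζ, h⟩

lemma injOn_inflectionalLine (hd : d ≠ 0) :
    Set.InjOn (fun x : Fin 3 × ℂ => inflectionalLine x.1 x.2)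
      (Set.univ ×ˢ {ζ | ζ ^ d = -1}) := by
  rintro ⟨i, ζ⟩ ⟨-, hζ⟩ ⟨j, ξ⟩ ⟨-, hξ⟩ h
  simp only [Set.mem_ofPred_eq] at hζ hξ h
  have hξ0 : ξ ≠ 0 := by
    rintro rfl
    rw [zero_pow hd] at hξ
    norm_num at hξ
  have hmem : ∀ v : Fin 3 → ℂ, v ≠ 0 → v (i + 1) = ζ * v (i + 2) → v (j + 1) = ξ * v (j + 2) :=
    fun v hv h1 => (mk_rep_apply_eq_mul_iff hv _ _ _).mp
      (h ▸ (mk_rep_apply_eq_mul_iff hv _ _ _).mpr h1 :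
        Projectivization.mk ℂ v hv ∈ inflectionalLine j ξ)
  -- Two test points recover the data of a line: the i-th coordinate point lies on no line of
  -- another index because ξ ≠ 0, and the point with x_i = 0 then determines ζ.
  have h1 := hmem (Pi.single i 1) (by simp) (by fin_cases i <;> simp)
  have hij : i = j := by
    revert h1
    fin_cases i <;> fin_cases j <;> simp [Ne.symm hξ0]
  subst hij
  have h2 := hmem (Pi.single (i + 1) ζ + Pi.single (i + 2) 1)
    (fun h => by simpa using congrFun h (i + 2)) (by fin_cases i <;> simp)
  have : ζ = ξ := by
    revert h2
    fin_cases i <;> simp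
  rw [this]

lemma ncard_pow_eq_neg_one (hd : d ≠ 0) : {ζ : ℂ | ζ ^ d = -1}.ncard = d := by
  classical
  have h : {ζ : ℂ | ζ ^ d = -1} = ((Polynomial.nthRoots d (-1 : ℂ)).toFinset : Set ℂ) := by
    ext ζ
    simp [Polynomial.mem_nthRoots (Nat.pos_of_ne_zero hd)]
  have hprim := Complex.isPrimitiveRoot_exp d hd
  rw [h, Set.ncard_coe_finset, Multiset.toFinset_card_of_nodup
    (hprim.nthRoots_nodup (by norm_num)), hprim.card_nthRoots, if_pos (exists_pow_eq_neg_one hd)]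

lemma ncard_inflectionalTangents_fermat (hd : 3 ≤ d) :
    (inflectionalTangents (fermat d)).ncard = 3 * d := by
  rw [inflectionalTangents_fermat hd, (injOn_inflectionalLine (by omega)).ncard_image,
    Set.ncard_prod, ncard_pow_eq_neg_one (by omega), Set.ncard_univ, Nat.card_eq_fintype_card,
    Fintype.card_fin]

lemma mem_zeroLocus_arrangementA (q : P2) :
    q ∈ zeroLocus (arrangementA d) ↔ ∃ i : Fin 3, q.rep (i + 1) ^ d + q.rep (i + 2) ^ d = 0 := by
  simp only [zeroLocus, arrangementA, Set.mem_ofPred_eq, map_mul, map_add, map_pow, eval_X,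
    mul_eq_zero, Fin.exists_fin_succ, IsEmpty.exists_iff, or_false]
  simp only [Fin.isValue, Fin.succ_zero_eq_one, Fin.succ_one_eq_two, zero_add]
  rw [show (1 : Fin 3) + 1 = 2 from rfl, show (1 : Fin 3) + 2 = 0 from rfl,
    show (2 : Fin 3) + 1 = 0 from rfl, show (2 : Fin 3) + 2 = 1 from rfl,
    add_comm (q.rep 2 ^ d) (q.rep 0 ^ d)]
  tauto

lemma sUnion_inflectionalTangents_fermat (hd : 3 ≤ d) :
    ⋃₀ inflectionalTangents (fermat d) = zeroLocus (arrangementA d) := by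
  ext q
  rw [inflectionalTangents_fermat hd, mem_zeroLocus_arrangementA]
  simp [pow_add_pow_eq_zero_iff (show d ≠ 0 by omega), inflectionalLine]

/-! ### The support of `C'` -/

lemma zeroLocus_mul (F G : S) : zeroLocus (F * G) = zeroLocus F ∪ zeroLocus G := by
  ext p
  simp [zeroLocus]

lemma zeroLocus_curveC' (d : ℕ) :
    zeroLocus (curveC' d) =
      zeroLocus (fermat d) ∪ zeroLocus (arrangementA d) ∪ ⋃ i : Fin 3, zeroLocus (X i) := by
  have h : ⋃ i : Fin 3, zeroLocus (X i) = zeroLocus (X 0) ∪ zeroLocus (X 1) ∪ zeroLocus (X 2) := by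
    ext p
    simp [Fin.exists_fin_succ, or_assoc]
  rw [h, curveC', zeroLocus_mul, zeroLocus_mul, zeroLocus_mul, zeroLocus_mul]
  ac_rfl

end Inflection

/-! ### Intersection multiplicities in a two-dimensional local ring -/

section IntersectionRank

variable {R : Type*} [CommRing R] [Algebra ℂ R]

/-- The dimension of `R ⧸ (a, b)` as a cardinal. -/
noncomputable def intersectionRank (a b : R) : Cardinal := Module.rank ℂ (R ⧸ Ideal.span {a, b})

lemma intersectionRank_comm (a b : R) : intersectionRank a b = intersectionRank b a := by
  rw [intersectionRank, Ideal.span_pair_comm, intersectionRank]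

lemma intersectionRank_add_mul (a b c : R) :
    intersectionRank a (b + c * a) = intersectionRank a b := by
  rw [intersectionRank, Ideal.span_pair_comm, Ideal.span_pair_add_mul_right, Ideal.span_pair_comm,
    intersectionRank]

lemma intersectionRank_mul_of_isUnit {u : R} (hu : IsUnit u) (a b : R) :
    intersectionRank a (u * b) = intersectionRank a b := by
  rw [intersectionRank, intersectionRank, Ideal.span_insert, Ideal.span_insert,
    Ideal.span_singleton_mul_left_unit hu]

variable [IsDomain R] [UniqueFactorizationMonoid R]

/-- Additivity of the intersection multiplicity. -/
lemma intersectionRank_mul {a b c : R} (ha : a ≠ 0) (hac : IsRelPrime a c) :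
    intersectionRank c (a * b) = intersectionRank c a + intersectionRank c b := by
  have hle : Ideal.span {c, a * b} ≤ Ideal.span {c, a} := by
    rw [Ideal.span_le]
    rintro x (rfl | rfl)
    · exact Ideal.subset_span (by simp)
    · exact Ideal.mul_mem_right _ _ (Ideal.subset_span (by simp))
  -- The exact sequence 0 → R/(c, b) → R/(c, ab) → R/(c, a) → 0, whose first map is multiplication
  -- by a; it is injective because a is coprime to c.
  let f : (R ⧸ Ideal.span {c, a * b}) →ₗ[R] (R ⧸ Ideal.span {c, a}) :=
    Submodule.mapQ _ _ LinearMap.id hle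
  have hg : Ideal.span {c, b} ≤
      Submodule.comap (LinearMap.mulLeft R a) (Ideal.span {c, a * b}) := by
    intro x hx
    obtain ⟨p, q, rfl⟩ := Ideal.mem_span_pair.mp hx
    exact Ideal.mem_span_pair.mpr ⟨a * p, q, by rw [LinearMap.mulLeft_apply]; ring⟩
  let g : (R ⧸ Ideal.span {c, b}) →ₗ[R] (R ⧸ Ideal.span {c, a * b}) :=
    Submodule.mapQ _ _ (LinearMap.mulLeft R a) hg
  have hf : Function.Surjective (f.restrictScalars ℂ) := by
    intro x
    obtain ⟨r, rfl⟩ := Submodule.Quotient.mk_surjective _ x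
    exact ⟨Submodule.Quotient.mk r, rfl⟩
  have hginj : Function.Injective (g.restrictScalars ℂ) := by
    rw [injective_iff_map_eq_zero]
    intro x hx
    obtain ⟨r, rfl⟩ := Submodule.Quotient.mk_surjective _ x
    have h1 : a * r ∈ Ideal.span {c, a * b} := (Submodule.Quotient.mk_eq_zero _).mp hx
    obtain ⟨p, q, hpq⟩ := Ideal.mem_span_pair.mp h1
    obtain ⟨k, rfl⟩ : a ∣ p := hac.dvd_of_dvd_mul_right ⟨r - q * b, by linear_combination hpq⟩
    refine (Submodule.Quotient.mk_eq_zero _).mpr (Ideal.mem_span_pair.mpr ⟨k, q, ?_⟩)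
    exact mul_left_cancel₀ ha (by linear_combination hpq)
  have hker : (f.restrictScalars ℂ).ker = (g.restrictScalars ℂ).range := by
    ext x
    obtain ⟨r, rfl⟩ := Submodule.Quotient.mk_surjective _ x
    rw [LinearMap.mem_ker, LinearMap.mem_range]
    constructor
    · intro h
      have h1 : r ∈ Ideal.span {c, a} := (Submodule.Quotient.mk_eq_zero _).mp h
      obtain ⟨p, q, rfl⟩ := Ideal.mem_span_pair.mp h1
      refine ⟨Submodule.Quotient.mk q, (Submodule.Quotient.eq _).mpr ?_⟩
      exact Ideal.mem_span_pair.mpr ⟨-p, 0, by simp; ring⟩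
    · rintro ⟨y, hy⟩
      obtain ⟨q, rfl⟩ := Submodule.Quotient.mk_surjective _ y
      rw [← hy]
      exact (Submodule.Quotient.mk_eq_zero _).mpr (Ideal.mem_span_pair.mpr ⟨0, q, by simp; ring⟩)
  have h := LinearMap.rank_range_add_rank_ker (f.restrictScalars ℂ)
  rw [hker, LinearMap.range_eq_top.mpr hf, rank_top, rank_range_of_injective _ hginj] at h
  exact h.symm

lemma intersectionRank_sq {a c : R} (ha : a ≠ 0) (hac : IsRelPrime a c) :
    intersectionRank c (a ^ 2) = intersectionRank c a + intersectionRank c a := by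
  rw [pow_two, intersectionRank_mul ha hac]

variable {s t : R}

omit [IsDomain R] [UniqueFactorizationMonoid R] in
lemma isUnit_ofNat (n : ℕ) (hn : n ≠ 0) : IsUnit (n : R) := by
  have := IsUnit.map (algebraMap ℂ R) (isUnit_iff_ne_zero.mpr (Nat.cast_ne_zero (R := ℂ).mpr hn))
  rwa [map_natCast] at this

/-- The generators are the s- and t-partials of t(s² + t²). Splitting st leaves (s, t²) and (t, s²),
each of length 2. -/
lemma intersectionRank_D4 (hs : s ≠ 0) (ht : t ≠ 0) (hst : IsRelPrime s t)
    (h1 : intersectionRank s t = 1) :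
    intersectionRank (2 * (s * t)) (s ^ 2 + 3 * t ^ 2) = 4 := by
  have h2 : IsUnit (2 : R) := by exact_mod_cast isUnit_ofNat (R := R) 2 (by norm_num)
  have h3 : IsUnit (3 : R) := by exact_mod_cast isUnit_ofNat (R := R) 3 (by norm_num)
  have e1 : intersectionRank (s ^ 2 + 3 * t ^ 2) s = 2 := by
    rw [intersectionRank_comm, show s ^ 2 + 3 * t ^ 2 = 3 * t ^ 2 + s * s by ring,
      intersectionRank_add_mul, intersectionRank_mul_of_isUnit h3,
      intersectionRank_sq ht hst.symm, h1]
    norm_num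
  have e2 : intersectionRank (s ^ 2 + 3 * t ^ 2) t = 2 := by
    rw [intersectionRank_comm, show s ^ 2 + 3 * t ^ 2 = s ^ 2 + (3 * t) * t by ring,
      intersectionRank_add_mul, intersectionRank_sq hs hst, intersectionRank_comm, h1]
    norm_num
  have hrel : IsRelPrime s (s ^ 2 + 3 * t ^ 2) := by
    rw [show s ^ 2 + 3 * t ^ 2 = 3 * (t * t) + s * s by ring]
    exact ((h3.isRelPrime_right).mul_right (hst.mul_right hst)).add_mul_left_right s
  rw [intersectionRank_comm, intersectionRank_mul_of_isUnit h2, intersectionRank_mul hs hrel,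
    e1, e2]
  norm_num

/-- The generators are the partials of ts(s + t²). Splitting both products leaves three pairs of
length 2; in the last one, 2s + t² = -5t² + 2(s + 3t²) reduces to (s, t²). -/
lemma intersectionRank_D6 (hs : s ≠ 0) (ht : t ≠ 0) (hst : IsRelPrime s t)
    (h1 : intersectionRank s t = 1) :
    intersectionRank (t * (2 * s + t ^ 2)) (s * (s + 3 * t ^ 2)) = 6 := by
  have h2 : IsUnit (2 : R) := by exact_mod_cast isUnit_ofNat (R := R) 2 (by norm_num)
  have h5 : IsUnit (-5 : R) := by
    rw [IsUnit.neg_iff]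
    exact_mod_cast isUnit_ofNat (R := R) 5 (by norm_num)
  have hts : IsRelPrime t (s * (s + 3 * t ^ 2)) := by
    refine hst.symm.mul_right ?_
    rw [show s + 3 * t ^ 2 = s + t * (3 * t) by ring]
    exact hst.symm.add_mul_left_right _
  have hsq : IsRelPrime s (2 * s + t ^ 2) := by
    rw [show 2 * s + t ^ 2 = t * t + s * 2 by ring]
    exact (hst.mul_right hst).add_mul_left_right _
  have e0 : intersectionRank s (t ^ 2) = 2 := by
    rw [intersectionRank_sq ht hst.symm, h1]
    norm_num
  have e1 : intersectionRank (s * (s + 3 * t ^ 2)) t = 2 := by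
    rw [intersectionRank_comm, show s * (s + 3 * t ^ 2) = s ^ 2 + (3 * t * s) * t by ring,
      intersectionRank_add_mul, intersectionRank_sq hs hst, intersectionRank_comm, h1]
    norm_num
  have e2 : intersectionRank (2 * s + t ^ 2) s = 2 := by
    rw [intersectionRank_comm, show 2 * s + t ^ 2 = t ^ 2 + 2 * s by ring,
      intersectionRank_add_mul, e0]
  have e3 : intersectionRank (2 * s + t ^ 2) (s + 3 * t ^ 2) = 2 := by
    rw [intersectionRank_comm, show 2 * s + t ^ 2 = -5 * t ^ 2 + 2 * (s + 3 * t ^ 2) by ring,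
      intersectionRank_add_mul, intersectionRank_mul_of_isUnit h5, intersectionRank_comm,
      intersectionRank_add_mul,
      intersectionRank_comm, e0]
  rw [intersectionRank_comm, intersectionRank_mul ht hts, e1, intersectionRank_comm,
    intersectionRank_mul hs hsq, e2, e3]
  norm_num

end IntersectionRank

/-! ### Tjurina numbers of singularities in normal form -/

section Tjurina

/-- The canonical map from the polynomial ring to the local ring at `w`. -/
noncomputable abbrev germ (w : Fin 2 → ℂ) : MvPolynomial (Fin 2) ℂ →+* LocalRingAt w :=
  algebraMap (MvPolynomial (Fin 2) ℂ) (LocalRingAt w)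

variable {w : Fin 2 → ℂ}

lemma germ_injective (w : Fin 2 → ℂ) : Function.Injective (germ w) :=
  IsLocalization.injective (LocalRingAt w) (Ideal.primeCompl_le_nonZeroDivisors (pointIdeal w))

lemma germ_ne_zero {p : MvPolynomial (Fin 2) ℂ} (hp : p ≠ 0) : germ w p ≠ 0 := by
  rwa [Ne, map_eq_zero_iff _ (germ_injective w)]

lemma isUnit_germ {u : MvPolynomial (Fin 2) ℂ} (hu : eval w u ≠ 0) : IsUnit (germ w u) :=
  IsLocalization.map_units (M := (pointIdeal w).primeCompl) (LocalRingAt w)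
    ⟨u, fun h => hu (RingHom.mem_ker.mp h)⟩

lemma not_isUnit_germ {p : MvPolynomial (Fin 2) ℂ} (hp : eval w p = 0) : ¬ IsUnit (germ w p) := by
  intro h
  rw [IsLocalization.AtPrime.isUnit_to_map_iff (LocalRingAt w) (pointIdeal w)] at h
  exact h (RingHom.mem_ker.mpr hp)

/-- Every germ is a quotient of polynomials. -/
lemma exists_germ_mul_eq (r : LocalRingAt w) :
    ∃ n v : MvPolynomial (Fin 2) ℂ, eval w v ≠ 0 ∧ r * germ w v = germ w n := by
  obtain ⟨⟨n, v⟩, h⟩ := IsLocalization.surj (pointIdeal w).primeCompl r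
  exact ⟨n, v, fun hv => v.2 (RingHom.mem_ker.mpr hv), h⟩

/-- After clearing denominators, a nonunit common divisor of the germs has a numerator vanishing at
w. A prime factor of it through w cannot divide the denominators, so it divides both polynomials. -/
lemma isRelPrime_germ {a b : MvPolynomial (Fin 2) ℂ} (h : IsRelPrime a b) :
    IsRelPrime (germ w a) (germ w b) := by
  intro d hda hdb
  obtain ⟨n, v, hv, hn⟩ := exists_germ_mul_eq d
  have hnd : ∀ c, d ∣ germ w c → ∃ t, eval w t ≠ 0 ∧ n ∣ c * t := by
    rintro c ⟨e, he⟩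
    obtain ⟨m, t, ht, hm⟩ := exists_germ_mul_eq e
    refine ⟨v * t, by rw [map_mul]; exact mul_ne_zero hv ht, m, germ_injective w ?_⟩
    rw [map_mul, map_mul, map_mul, he, ← hn, ← hm]
    ring
  obtain ⟨t₁, ht₁, h₁⟩ := hnd a hda
  obtain ⟨t₂, ht₂, h₂⟩ := hnd b hdb
  have hnw : eval w n ≠ 0 := by
    intro hnw
    have hn0 : n ≠ 0 := by
      rintro rfl
      have ht : ∀ {c t : MvPolynomial (Fin 2) ℂ}, eval w t ≠ 0 → 0 ∣ c * t → c = 0 :=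
        fun ht h0 => (mul_eq_zero.mp (zero_dvd_iff.mp h0)).resolve_right
          fun h => ht (by rw [h, map_zero])
      have := h.ne_zero_or_ne_zero
      rw [ht ht₁ h₁, ht ht₂ h₂] at this
      simp at this
    obtain ⟨f, hf, hfn⟩ := UniqueFactorizationMonoid.exists_prime_factors n hn0
    have hmem : f.prod ∈ pointIdeal w := by
      obtain ⟨u, hu⟩ := hfn.symm
      rw [← hu]
      exact Ideal.mul_mem_right _ _ (RingHom.mem_ker.mpr hnw)
    obtain ⟨p, hp, hpw⟩ := ((inferInstance :
      (pointIdeal w).IsPrime).multiset_prod_mem_iff_exists_mem f).mp hmem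
    have hpn : p ∣ n := (Multiset.dvd_prod hp).trans hfn.dvd
    have hpt : ∀ {c t : MvPolynomial (Fin 2) ℂ}, eval w t ≠ 0 → n ∣ c * t → p ∣ c := by
      intro c t ht hc
      refine ((hf p hp).dvd_or_dvd (hpn.trans hc)).resolve_right ?_
      rintro ⟨k, rfl⟩
      rw [map_mul, RingHom.mem_ker.mp hpw, zero_mul] at ht
      exact ht rfl
    exact (hf p hp).not_isUnit (h (hpt ht₁ h₁) (hpt ht₂ h₂))
  exact isUnit_of_mul_isUnit_left (hn ▸ isUnit_germ hnw)

lemma sub_C_eval_mem (w : Fin 2 → ℂ) (p : MvPolynomial (Fin 2) ℂ) :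
    p - C (eval w p) ∈ Ideal.span {X 0 - C (w 0), X 1 - C (w 1)} := by
  induction p using MvPolynomial.induction_on with
  | C a => simp
  | add p q hp hq =>
    rw [map_add, C_add, add_sub_add_comm]
    exact add_mem hp hq
  | mul_X p i hp =>
    have h : (X i - C (w i) : MvPolynomial (Fin 2) ℂ) ∈
        Ideal.span {X 0 - C (w 0), X 1 - C (w 1)} := by
      fin_cases i
      · exact Ideal.subset_span (by simp)
      · exact Ideal.subset_span (by simp)
    rw [map_mul, eval_X, C_mul, show p * X i - C (eval w p) * C (w i) =
      (p - C (eval w p)) * X i + C (eval w p) * (X i - C (w i)) by ring]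
    exact add_mem (Ideal.mul_mem_right _ _ hp) (Ideal.mul_mem_left _ _ h)

/-- The two coordinates generate the kernel of evaluation at w, and the quotient is the residue
field ℂ. -/
lemma intersectionRank_coordinates (w : Fin 2 → ℂ) :
    intersectionRank (germ w (X 0 - C (w 0))) (germ w (X 1 - C (w 1))) = 1 := by
  set I : Ideal (LocalRingAt w) :=
    Ideal.span {germ w (X 0 - C (w 0)), germ w (X 1 - C (w 1))} with hI
  have hmap : ∀ p, germ w p - algebraMap ℂ (LocalRingAt w) (eval w p) ∈ I := by
    intro p
    have h := Ideal.mem_map_of_mem (germ w) (sub_C_eval_mem w p)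
    rw [Ideal.map_span, Set.image_pair, map_sub (germ w) p] at h
    exact h
  let f : ℂ →ₗ[ℂ] LocalRingAt w ⧸ I := Algebra.linearMap ℂ _
  have hf : ∀ c, f c = Ideal.Quotient.mk I (algebraMap ℂ (LocalRingAt w) c) := fun c => rfl
  have hle : I ≤ IsLocalRing.maximalIdeal (LocalRingAt w) := by
    rw [hI, Ideal.span_le]
    rintro x (rfl | rfl)
    · exact not_isUnit_germ (by simp)
    · exact not_isUnit_germ (by simp)
  have hinj : Function.Injective f := by
    rw [injective_iff_map_eq_zero]
    intro c hc
    by_contra hc0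
    rw [hf, Ideal.Quotient.eq_zero_iff_mem] at hc
    exact hle hc ((isUnit_iff_ne_zero.mpr hc0).map _)
  have hsurj : Function.Surjective f := by
    intro x
    obtain ⟨r, rfl⟩ := Ideal.Quotient.mk_surjective x
    obtain ⟨n, v, hv, hr⟩ := exists_germ_mul_eq r
    refine ⟨eval w n / eval w v, ?_⟩
    rw [hf, Ideal.Quotient.eq]
    have h1 := Ideal.mul_mem_left I (algebraMap ℂ _ (eval w v)⁻¹)
      (I.sub_mem (Ideal.mul_mem_left I r (hmap v)) (hmap n))
    have h2 : algebraMap ℂ (LocalRingAt w) (eval w v)⁻¹ * algebraMap ℂ _ (eval w v) = 1 := by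
      rw [← map_mul, inv_mul_cancel₀ hv, map_one]
    rw [div_eq_mul_inv, map_mul]
    convert h1 using 1
    rw [mul_sub r, hr]
    linear_combination r * h2
  exact (LinearEquiv.ofBijective f ⟨hinj, hsurj⟩).rank_eq.symm.trans (Module.rank_self ℂ)

/-- `s` and `t` are, up to invertible factors, the two coordinates at `w`, in some order. -/
def IsCoordinatePair (w : Fin 2 → ℂ) (s t : MvPolynomial (Fin 2) ℂ) : Prop :=
  ∃ i j u v, i ≠ j ∧ s = (X i - C (w i)) * u ∧ t = (X j - C (w j)) * v ∧
    eval w u ≠ 0 ∧ eval w v ≠ 0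

namespace IsCoordinatePair

variable {s t : MvPolynomial (Fin 2) ℂ}

lemma symm (h : IsCoordinatePair w s t) : IsCoordinatePair w t s := by
  obtain ⟨i, j, u, v, hij, hs, ht, hu, hv⟩ := h
  exact ⟨j, i, v, u, hij.symm, ht, hs, hv, hu⟩

lemma eval_left (h : IsCoordinatePair w s t) : eval w s = 0 := by
  obtain ⟨i, j, u, v, hij, rfl, ht, hu, hv⟩ := h
  simp

lemma eval_right (h : IsCoordinatePair w s t) : eval w t = 0 := h.symm.eval_left

lemma ne_zero_left (h : IsCoordinatePair w s t) : germ w s ≠ 0 := by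
  obtain ⟨i, j, u, v, hij, rfl, ht, hu, hv⟩ := h
  refine germ_ne_zero (mul_ne_zero ?_ ?_)
  · intro h
    have := congrArg (eval fun k => w k + 1) h
    simp at this
  · rintro rfl
    simp at hu

lemma ne_zero_right (h : IsCoordinatePair w s t) : germ w t ≠ 0 := h.symm.ne_zero_left

lemma jacobian_ne_zero (h : IsCoordinatePair w s t) :
    eval w (pderiv 0 s) * eval w (pderiv 1 t) - eval w (pderiv 1 s) * eval w (pderiv 0 t) ≠ 0 := by
  obtain ⟨i, j, u, v, hij, rfl, rfl, hu, hv⟩ := h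
  fin_cases i <;> fin_cases j <;> simp [pderiv_X, hu, hv] at hij ⊢

lemma isRelPrime (h : IsCoordinatePair w s t) : IsRelPrime (germ w s) (germ w t) := by
  obtain ⟨i, j, u, v, hij, rfl, rfl, hu, hv⟩ := h
  have hne : ∀ i, (X i - C (w i) : MvPolynomial (Fin 2) ℂ) ≠ 0 := by
    intro i h
    have := congrArg (eval fun k => w k + 1) h
    simp at this
  have hdeg : ∀ i k, k ≠ i → degreeOf k (X i - C (w i) : MvPolynomial (Fin 2) ℂ) = 0 := by
    intro i k hk
    refine Nat.le_zero.mp ((degreeOf_sub_le _ _ _).trans ?_)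
    simp [degreeOf_X_of_ne hk]
  have hrel : IsRelPrime (X i - C (w i)) (X j - C (w j) : MvPolynomial (Fin 2) ℂ) := by
    intro d hdi hdj
    refine isUnit_of_degreeOf_eq_zero (ne_zero_of_dvd_ne_zero (hne i) hdi) fun k => ?_
    by_cases hk : k = i
    · exact Nat.le_zero.mp (hdeg j k (hk ▸ hij) ▸ degreeOf_le_of_dvd k (hne j) hdj)
    · exact Nat.le_zero.mp (hdeg i k hk ▸ degreeOf_le_of_dvd k (hne i) hdi)
  rw [map_mul, map_mul]
  exact ((isRelPrime_germ hrel).mul_left (isUnit_germ hu).isRelPrime_left).mul_right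
    (isUnit_germ hv).isRelPrime_right

lemma intersectionRank_eq_one (h : IsCoordinatePair w s t) :
    intersectionRank (germ w s) (germ w t) = 1 := by
  obtain ⟨i, j, u, v, hij, rfl, rfl, hu, hv⟩ := h
  rw [map_mul, map_mul, mul_comm _ (germ w v), intersectionRank_mul_of_isUnit (isUnit_germ hv),
    intersectionRank_comm, mul_comm _ (germ w u), intersectionRank_mul_of_isUnit (isUnit_germ hu)]
  fin_cases i <;> fin_cases j
  · exact absurd rfl hij
  · exact (intersectionRank_comm _ _).trans (intersectionRank_coordinates w)
  · exact intersectionRank_coordinates w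
  · exact absurd rfl hij

end IsCoordinatePair

/-- If `f` is a unit times `g (s, t)` with `s`, `t` local coordinates at `w` and `g` in its Jacobian
ideal, then the Tjurina ideal is generated by the two partial derivatives of `g`. -/
lemma tjurinaIdeal_eq {f g h s t gs gt p q : MvPolynomial (Fin 2) ℂ} (hf : f = g * h)
    (hst : IsCoordinatePair w s t)
    (hg : ∀ i, pderiv i g = gs * pderiv i s + gt * pderiv i t) (hgst : g = p * gs + q * gt)
    (hh : eval w h ≠ 0) :
    tjurinaIdeal f w = Ideal.span {germ w gs, germ w gt} := by
  have hdet : IsUnit (germ w (pderiv 0 s * pderiv 1 t - pderiv 1 s * pderiv 0 t)) :=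
    isUnit_germ (by simpa using hst.jacobian_ne_zero)
  have hhu := isUnit_germ hh
  rw [tjurinaIdeal, Ideal.map_span]
  have hfg : ∀ i, germ w (pderiv i f) = germ w h * (germ w gs * germ w (pderiv i s) +
      germ w gt * germ w (pderiv i t)) + germ w g * germ w (pderiv i h) := fun i => by
    rw [hf, pderiv_mul, hg]
    simp only [map_add, map_mul]
    ring
  have hgg : germ w g = germ w p * germ w gs + germ w q * germ w gt := by
    rw [hgst]; simp only [map_add, map_mul]
  apply le_antisymm
  · rw [Ideal.span_le]
    have hs : germ w gs ∈ Ideal.span {germ w gs, germ w gt} := Ideal.subset_span (by simp)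
    have ht : germ w gt ∈ Ideal.span {germ w gs, germ w gt} := Ideal.subset_span (by simp)
    have hgm : germ w g ∈ Ideal.span {germ w gs, germ w gt} := by
      rw [hgg]
      exact add_mem (Ideal.mul_mem_left _ _ hs) (Ideal.mul_mem_left _ _ ht)
    have hgi : ∀ i, germ w (pderiv i f) ∈ Ideal.span {germ w gs, germ w gt} := fun i => by
      rw [hfg]
      exact add_mem (Ideal.mul_mem_left _ _ (add_mem (Ideal.mul_mem_right _ _ hs)
        (Ideal.mul_mem_right _ _ ht))) (Ideal.mul_mem_right _ _ hgm)
    rintro x ⟨y, (rfl | rfl | rfl), rfl⟩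
    · rw [hf, map_mul]
      exact Ideal.mul_mem_right _ _ hgm
    · exact hgi 0
    · exact hgi 1
  -- Conversely, g lies in J because h is a unit. The chain rule then gives a linear system for gs
  -- and gt modulo J, solved by Cramer's rule with invertible Jacobian.
  · set J := Ideal.span (germ w '' {f, pderiv 0 f, pderiv 1 f}) with hJ
    have hgm : germ w g ∈ J := by
      rw [← Ideal.mul_unit_mem_iff_mem J hhu, ← map_mul, ← hf]
      exact Ideal.subset_span ⟨f, by simp, rfl⟩
    have hgi : ∀ i, germ w gs * germ w (pderiv i s) + germ w gt * germ w (pderiv i t) ∈ J := by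
      intro i
      rw [← Ideal.unit_mul_mem_iff_mem J hhu, ← Ideal.add_mem_iff_left J
        (Ideal.mul_mem_right (germ w (pderiv i h)) _ hgm), ← hfg]
      exact Ideal.subset_span ⟨pderiv i f, by fin_cases i <;> simp, rfl⟩
    rw [Ideal.span_le]
    rintro x (rfl | rfl)
    · refine (Ideal.mul_unit_mem_iff_mem J hdet).mp ?_
      have := J.sub_mem (Ideal.mul_mem_right (germ w (pderiv 1 t)) _ (hgi 0))
        (Ideal.mul_mem_right (germ w (pderiv 0 t)) _ (hgi 1))
      convert this using 1
      simp only [map_sub, map_mul]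
      ring
    · refine (Ideal.mul_unit_mem_iff_mem J hdet).mp ?_
      have := J.sub_mem (Ideal.mul_mem_right (germ w (pderiv 0 s)) _ (hgi 1))
        (Ideal.mul_mem_right (germ w (pderiv 1 s)) _ (hgi 0))
      convert this using 1
      simp only [map_sub, map_mul]
      ring

variable {s t h : MvPolynomial (Fin 2) ℂ}

lemma finrank_tjurina_A1 (hst : IsCoordinatePair w s t) (hh : eval w h ≠ 0) :
    Module.finrank ℂ (LocalRingAt w ⧸ tjurinaIdeal (s * t * h) w) = 1 := by
  rw [tjurinaIdeal_eq (gs := t) (gt := s) (p := s) (q := 0) rfl hst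
    (fun i => by rw [pderiv_mul]; ring) (by ring) hh]
  have := hst.symm.intersectionRank_eq_one
  rw [intersectionRank] at this
  rw [Module.finrank, this, map_one]

lemma finrank_tjurina_D4 (hst : IsCoordinatePair w s t) (hh : eval w h ≠ 0) :
    Module.finrank ℂ (LocalRingAt w ⧸ tjurinaIdeal (t * (s ^ 2 + t ^ 2) * h) w) = 4 := by
  -- Euler's relation for a cubic form: both weights are 1/3.
  rw [tjurinaIdeal_eq (gs := 2 * (s * t)) (gt := s ^ 2 + 3 * t ^ 2) (p := C (1 / 3) * s)
    (q := C (1 / 3) * t) rfl hst (fun i => by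
      simp only [pderiv_mul, map_add, pderiv_pow]
      push_cast
      ring) ?_ hh]
  · have : intersectionRank (germ w (2 * (s * t))) (germ w (s ^ 2 + 3 * t ^ 2)) = 4 := by
      simp only [map_mul, map_add, map_pow, map_ofNat]
      exact intersectionRank_D4 hst.ne_zero_left hst.ne_zero_right hst.isRelPrime
        hst.intersectionRank_eq_one
    rw [intersectionRank] at this
    rw [Module.finrank, this, Cardinal.toNat_ofNat]
  · have h3 : (C (1 / 3) : MvPolynomial (Fin 2) ℂ) * 3 = 1 := by
      rw [← map_ofNat C 3, ← C_mul]
      norm_num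
    linear_combination (-(t * (s ^ 2 + t ^ 2))) * h3

lemma finrank_tjurina_D6 (hst : IsCoordinatePair w s t) (hh : eval w h ≠ 0) :
    Module.finrank ℂ (LocalRingAt w ⧸ tjurinaIdeal (t * s * (s + t ^ 2) * h) w) = 6 := by
  -- The form ts² + t³s is quasi-homogeneous with weights 2/5 for s and 1/5 for t.
  rw [tjurinaIdeal_eq (gs := t * (2 * s + t ^ 2)) (gt := s * (s + 3 * t ^ 2))
    (p := C (2 / 5) * s) (q := C (1 / 5) * t) rfl hst (fun i => by
      simp only [pderiv_mul, map_add, pderiv_pow]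
      push_cast
      ring) ?_ hh]
  · have : intersectionRank (germ w (t * (2 * s + t ^ 2))) (germ w (s * (s + 3 * t ^ 2))) = 6 := by
      simp only [map_mul, map_add, map_pow, map_ofNat]
      exact intersectionRank_D6 hst.ne_zero_left hst.ne_zero_right hst.isRelPrime
        hst.intersectionRank_eq_one
    rw [intersectionRank] at this
    rw [Module.finrank, this, Cardinal.toNat_ofNat]
  · have h5 : (C (1 / 5) : MvPolynomial (Fin 2) ℂ) * 5 = 1 := by
      rw [← map_ofNat C 5, ← C_mul]
      norm_num
    have h25 : (C (2 / 5) : MvPolynomial (Fin 2) ℂ) = C (1 / 5) * 2 := by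
      rw [← map_ofNat C 2, ← C_mul]
      norm_num
    rw [h25]
    linear_combination (-(t * s * (s + t ^ 2))) * h5

end Tjurina

/-! ### Germ equivalences given by polynomial maps -/

section GermEquivalence

variable {w : Fin 2 → ℂ}

lemma hasFDerivAt_eval (P : MvPolynomial (Fin 2) ℂ) (w : Fin 2 → ℂ) :
    HasFDerivAt (fun q : Fin 2 → ℂ => eval q P)
      (∑ i, eval w (pderiv i P) • ContinuousLinearMap.proj (R := ℂ) (φ := fun _ : Fin 2 => ℂ) i)
      w := by
  induction P using MvPolynomial.induction_on with
  | C a =>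
    simp only [eval_C]
    refine (hasFDerivAt_const (𝕜 := ℂ) a w).congr_fderiv ?_
    ext v
    simp
  | add p q hp hq =>
    simp only [map_add]
    refine (hp.fun_add hq).congr_fderiv ?_
    ext v
    simp
    ring
  | mul_X p i hp =>
    have h := hp.mul (hasFDerivAt_apply (𝕜 := ℂ) i w)
    simp only [map_mul, eval_X]
    refine h.congr_fderiv ?_
    ext v
    fin_cases i <;> simp [pderiv_X] <;> ring

lemma germEquivalent_of_polynomial {f g U : MvPolynomial (Fin 2) ℂ}
    (P : Fin 2 → MvPolynomial (Fin 2) ℂ) (hP : ∀ k, eval w (P k) = 0)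
    (hjac : eval w (pderiv 0 (P 0)) * eval w (pderiv 1 (P 1)) -
      eval w (pderiv 1 (P 0)) * eval w (pderiv 0 (P 1)) ≠ 0)
    (hU : eval w U ≠ 0) (hf : f = U * aeval P g) : GermEquivalent f w g := by
  let L : (Fin 2 → ℂ) →L[ℂ] (Fin 2 → ℂ) := ContinuousLinearMap.pi fun k =>
    ∑ i, eval w (pderiv i (P k)) • ContinuousLinearMap.proj (R := ℂ) (φ := fun _ : Fin 2 => ℂ) i
  have hL : ∀ v k, L v k = eval w (pderiv 0 (P k)) * v 0 + eval w (pderiv 1 (P k)) * v 1 := by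
    intro v k
    simp [L]
  have hinj : Function.Injective (L : (Fin 2 → ℂ) →ₗ[ℂ] (Fin 2 → ℂ)) := by
    rw [injective_iff_map_eq_zero]
    intro v hv
    have h0 : L v 0 = 0 := congrFun hv 0
    have h1 : L v 1 = 0 := congrFun hv 1
    rw [hL] at h0 h1
    refine funext fun i => (mul_eq_zero.mp ?_).resolve_left hjac
    fin_cases i
    · simp only [Fin.zero_eta]
      linear_combination eval w (pderiv 1 (P 1)) * h0 - eval w (pderiv 1 (P 0)) * h1
    · simp only [Fin.mk_one]
      linear_combination eval w (pderiv 0 (P 0)) * h1 - eval w (pderiv 0 (P 1)) * h0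
  refine ⟨fun q k => eval q (P k),
    (LinearEquiv.ofInjectiveEndo (L : (Fin 2 → ℂ) →ₗ[ℂ] (Fin 2 → ℂ))
      hinj).toContinuousLinearEquiv, fun q => eval q U, ?_, funext hP, ?_, ?_, hU, ?_⟩
  · exact AnalyticAt.pi fun k => AnalyticOnNhd.eval_mvPolynomial (P k) w (Set.mem_univ w)
  · have h : HasFDerivAt (fun (q : Fin 2 → ℂ) k => eval q (P k)) L w :=
      hasFDerivAt_pi.mpr fun k => hasFDerivAt_eval (P k) w
    refine h.congr_fderiv ?_
    ext v
    rfl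
  · exact AnalyticOnNhd.eval_mvPolynomial U w (Set.mem_univ w)
  · refine Filter.Eventually.of_forall fun q => ?_
    rw [hf, map_mul]
    congr 1
    have h : (eval q).comp (aeval P : MvPolynomial (Fin 2) ℂ →ₐ[ℂ] _).toRingHom =
        eval fun k => eval q (P k) := by
      ext <;> simp
    exact congrArg (fun φ => φ g) h

variable {s t h : MvPolynomial (Fin 2) ℂ}

lemma germEquivalent_A1 (hst : IsCoordinatePair w s t) (hh : eval w h ≠ 0) :
    GermEquivalent (s * t * h) w (X 0 ^ 2 + X 1 ^ (1 + 1)) := by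
  have hj := hst.jacobian_ne_zero
  -- st = ((s+t)/2)² + (i(s-t)/2)².
  refine germEquivalent_of_polynomial (U := h)
    ![C (1 / 2) * (s + t), C (Complex.I / 2) * (s - t)] ?_ ?_ hh ?_
  · intro k
    fin_cases k <;> simp [hst.eval_left, hst.eval_right]
  · simp only [Matrix.cons_val_zero, Matrix.cons_val_one, pderiv_C_mul, map_mul, map_add, map_sub,
      eval_C]
    intro h0
    refine hj (mul_left_cancel₀ (a := -Complex.I / 2) (by simp) ?_)
    linear_combination h0
  · have h1 : (C (Complex.I / 2) : MvPolynomial (Fin 2) ℂ) ^ 2 = -C (1 / 2) ^ 2 := by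
      rw [← C_pow, ← C_pow, ← C_neg, div_pow, Complex.I_sq]
      norm_num
    have h2 : (C (1 / 2) : MvPolynomial (Fin 2) ℂ) ^ 2 * 4 = 1 := by
      rw [← map_ofNat C 4, ← C_pow, ← C_mul]
      norm_num
    simp only [map_add, map_pow, aeval_X, Matrix.cons_val_zero, Matrix.cons_val_one]
    linear_combination (-(s * t * h)) * h2 - h * (s - t) ^ 2 * h1

lemma germEquivalent_D4 (hst : IsCoordinatePair w s t) (hh : eval w h ≠ 0) :
    GermEquivalent (t * (s ^ 2 + t ^ 2) * h) w (X 0 ^ 2 * X 1 + X 1 ^ (4 - 1)) := by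
  refine germEquivalent_of_polynomial (U := h) ![s, t] ?_ ?_ hh ?_
  · intro k
    fin_cases k
    · exact hst.eval_left
    · exact hst.eval_right
  · exact hst.jacobian_ne_zero
  · simp only [map_add, map_mul, map_pow, aeval_X, Matrix.cons_val_zero, Matrix.cons_val_one]
    ring

lemma germEquivalent_D6 (hst : IsCoordinatePair w s t) (hh : eval w h ≠ 0) :
    GermEquivalent (t * s * (s + t ^ 2) * h) w (X 0 ^ 2 * X 1 + X 1 ^ (6 - 1)) := by
  obtain ⟨κ, hκ⟩ := IsAlgClosed.exists_pow_nat_eq (-1 / 4 : ℂ) (show 0 < 4 by norm_num)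
  have hκ0 : κ ≠ 0 := by
    rintro rfl
    norm_num at hκ
  have hj := hst.jacobian_ne_zero
  -- Completing the square: s(s + t²) = (s + t²/2)² - t⁴/4. The choice κ⁴ = -1/4 turns the last term
  -- into (κt)⁴, and κ⁻¹ compensates for the outer factor t.
  refine germEquivalent_of_polynomial (U := C κ⁻¹ * h)
    ![s + C (1 / 2) * t ^ 2, C κ * t] ?_ ?_ ?_ ?_
  · intro k
    fin_cases k <;> simp [hst.eval_left, hst.eval_right]
  · simp only [Matrix.cons_val_zero, Matrix.cons_val_one, pderiv_C_mul, pderiv_pow, map_mul,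
      map_add, map_pow, eval_C, hst.eval_right]
    intro h0
    refine hj (mul_left_cancel₀ hκ0 ?_)
    simp only [show 2 - 1 = 1 from rfl, pow_one, mul_zero, zero_mul, add_zero] at h0
    linear_combination h0
  · rw [map_mul, eval_C]
    exact mul_ne_zero (inv_ne_zero hκ0) hh
  · have h1 : (C κ : MvPolynomial (Fin 2) ℂ) ^ 4 = -C (1 / 2) ^ 2 := by
      rw [← C_pow, ← C_pow, ← C_neg, hκ]
      norm_num
    have h2 : (C (1 / 2) : MvPolynomial (Fin 2) ℂ) * 2 = 1 := by
      rw [← map_ofNat C 2, ← C_mul]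
      norm_num
    have h3 : (C κ⁻¹ : MvPolynomial (Fin 2) ℂ) * C κ = 1 := by
      rw [← C_mul, inv_mul_cancel₀ hκ0, C_1]
    simp only [map_add, map_mul, map_pow, aeval_X, Matrix.cons_val_zero, Matrix.cons_val_one]
    linear_combination (-(t * s * (s + t ^ 2) * h)) * h3 - h * C κ⁻¹ * C κ * t ^ 5 * h1
      - h * C κ⁻¹ * C κ * s * t ^ 3 * h2

end GermEquivalence

/-! ### The curve `C''` for `d = 2` -/

section Octic

lemma eval_curveC''_two (v : Fin 3 → ℂ) :
    eval v (curveC'' 2) = (v 0 * (v 0 ^ 2 + v 2 ^ 2)) * (v 1 * (v 1 ^ 2 + v 2 ^ 2)) *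
      (v 0 ^ 2 + v 1 ^ 2 + v 2 ^ 2) := by
  simp only [curveC'', fermat, map_mul, map_add, map_pow, eval_X]
  ring

lemma eval_pderiv_zero_curveC''_two (v : Fin 3 → ℂ) :
    eval v (pderiv 0 (curveC'' 2)) = (3 * v 0 ^ 2 + v 2 ^ 2) * (v 1 * (v 1 ^ 2 + v 2 ^ 2)) *
      (v 0 ^ 2 + v 1 ^ 2 + v 2 ^ 2) +
      2 * v 0 * (v 0 * (v 0 ^ 2 + v 2 ^ 2)) * (v 1 * (v 1 ^ 2 + v 2 ^ 2)) := by
  simp [curveC'', fermat, pderiv_X]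
  ring

lemma eval_pderiv_one_curveC''_two (v : Fin 3 → ℂ) :
    eval v (pderiv 1 (curveC'' 2)) = (3 * v 1 ^ 2 + v 2 ^ 2) * (v 0 * (v 0 ^ 2 + v 2 ^ 2)) *
      (v 0 ^ 2 + v 1 ^ 2 + v 2 ^ 2) +
      2 * v 1 * (v 0 * (v 0 ^ 2 + v 2 ^ 2)) * (v 1 * (v 1 ^ 2 + v 2 ^ 2)) := by
  simp [curveC'', fermat, pderiv_X]
  ring

lemma eval_pderiv_two_curveC''_two (v : Fin 3 → ℂ) :
    eval v (pderiv 2 (curveC'' 2)) = 2 * v 2 * (v 0 * (v 1 * (v 1 ^ 2 + v 2 ^ 2)) *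
      (v 0 ^ 2 + v 1 ^ 2 + v 2 ^ 2) + v 1 * (v 0 * (v 0 ^ 2 + v 2 ^ 2)) *
      (v 0 ^ 2 + v 1 ^ 2 + v 2 ^ 2) +
      (v 0 * (v 0 ^ 2 + v 2 ^ 2)) * (v 1 * (v 1 ^ 2 + v 2 ^ 2))) := by
  simp [curveC'', fermat, pderiv_X]
  ring

/-- Put A = x(x²+z²), B = y(y²+z²), Q = x²+y²+z². For z ≠ 0, A and B have simple roots in x and y,
and the conic Q = 0 meets A = 0 only on B = 0 and conversely; so a singular point must satisfy A = B
= 0. On z = 0 the equation is x³y³(x²+y²). -/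
lemma isSingularPoint_curveC''_two_iff (p : P2) :
    IsSingularPoint (curveC'' 2) p ↔
      (p.rep 2 ≠ 0 ∧ p.rep 0 * (p.rep 0 ^ 2 + p.rep 2 ^ 2) = 0 ∧
        p.rep 1 * (p.rep 1 ^ 2 + p.rep 2 ^ 2) = 0) ∨
      (p.rep 2 = 0 ∧ (p.rep 0 = 0 ∨ p.rep 1 = 0)) := by
  rw [IsSingularPoint, zeroLocus, Set.mem_ofPred_eq, eval_curveC''_two, Fin.forall_fin_succ,
    Fin.forall_fin_two]
  simp only [Fin.succ_zero_eq_one, Fin.succ_one_eq_two]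
  rw [eval_pderiv_zero_curveC''_two, eval_pderiv_one_curveC''_two, eval_pderiv_two_curveC''_two]
  generalize p.rep 0 = x
  generalize p.rep 1 = y
  generalize p.rep 2 = z
  constructor
  · rintro ⟨hF, hx, hy, -⟩
    by_cases hz : z = 0
    · refine .inr ⟨hz, ?_⟩
      subst hz
      by_contra! hxy
      obtain ⟨hx0, hy0⟩ := hxy
      have hQ : x ^ 2 + y ^ 2 = 0 := by
        simpa [hx0, hy0] using hF
      have : 2 * x ^ 4 * y ^ 3 = 0 := by linear_combination hx - 3 * x ^ 2 * y ^ 3 * hQ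
      simp [hx0, hy0] at this
    · refine .inl ⟨hz, ?_⟩
      by_cases hA : x * (x ^ 2 + z ^ 2) = 0
      · refine ⟨hA, ?_⟩
        by_contra hB
        have hA' : 3 * x ^ 2 + z ^ 2 ≠ 0 := by
          rcases mul_eq_zero.mp hA with h | h
          · simpa [h] using hz
          · intro h'
            apply hz
            have : z ^ 2 = 0 := by linear_combination (3 / 2) * h - (1 / 2) * h'
            exact pow_eq_zero_iff two_ne_zero |>.mp this
        have hQ : x ^ 2 + y ^ 2 + z ^ 2 = 0 := by
          rw [hA, mul_zero, zero_mul, add_zero] at hx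
          exact (mul_eq_zero.mp hx).resolve_left (mul_ne_zero hA' hB)
        rcases mul_eq_zero.mp hA with h | h
        · exact hB (by linear_combination y * hQ - x * y * h)
        · have : y ^ 2 = 0 := by linear_combination hQ - h
          have := pow_eq_zero_iff two_ne_zero |>.mp this
          exact hB (by rw [this, zero_mul])
      · exfalso
        have hx0 : x ≠ 0 := left_ne_zero_of_mul hA
        by_cases hB : y * (y ^ 2 + z ^ 2) = 0
        · have hB' : 3 * y ^ 2 + z ^ 2 ≠ 0 := by
            rcases mul_eq_zero.mp hB with h | h
            · simpa [h] using hz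
            · intro h'
              apply hz
              have : z ^ 2 = 0 := by linear_combination (3 / 2) * h - (1 / 2) * h'
              exact pow_eq_zero_iff two_ne_zero |>.mp this
          have hQ : x ^ 2 + y ^ 2 + z ^ 2 = 0 := by
            rw [hB, mul_zero, add_zero] at hy
            exact (mul_eq_zero.mp hy).resolve_left (mul_ne_zero hB' hA)
          rcases mul_eq_zero.mp hB with h | h
          · exact hA (by linear_combination x * hQ - x * y * h)
          · have : x ^ 2 = 0 := by linear_combination hQ - h
            exact hx0 (pow_eq_zero_iff two_ne_zero |>.mp this)
        · have hQ := (mul_eq_zero.mp hF).resolve_left (mul_ne_zero hA hB)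
          rw [hQ, mul_zero, zero_add] at hx
          exact (mul_ne_zero (mul_ne_zero (mul_ne_zero two_ne_zero hx0) hA) hB) hx
  · rintro (⟨-, hA, hB⟩ | ⟨rfl, rfl | rfl⟩)
    · rw [hA, hB]
      simp
    · simp
    · simp

/-- The point `(a : b : 1)`. -/
noncomputable def affinePoint (a b : ℂ) : P2 :=
  Projectivization.mk ℂ ![a, b, 1] fun h => by simpa using congrFun h 2

/-- The point `(1 : 0 : 0)`, for `i = 0`, or `(0 : 1 : 0)`, for `i = 1`. -/
noncomputable def pointAtInfinity (i : Fin 2) : P2 :=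
  Projectivization.mk ℂ (Pi.single i.castSucc 1) (by simp)

lemma exists_rep_affinePoint (a b : ℂ) :
    ∃ c : ℂ, c ≠ 0 ∧ (affinePoint a b).rep = ![c * a, c * b, c] := by
  obtain ⟨c, hc⟩ := Projectivization.exists_smul_eq_mk_rep ℂ ![a, b, 1]
    (fun h => by simpa using congrFun h 2)
  refine ⟨c, c.ne_zero, hc.symm.trans ?_⟩
  ext i
  fin_cases i <;> simp [Units.smul_def]

lemma exists_rep_pointAtInfinity (i : Fin 2) :
    ∃ c : ℂ, c ≠ 0 ∧ (pointAtInfinity i).rep = Pi.single i.castSucc c := by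
  obtain ⟨c, hc⟩ := Projectivization.exists_smul_eq_mk_rep ℂ
    (Pi.single i.castSucc 1 : Fin 3 → ℂ) (by simp)
  refine ⟨c, c.ne_zero, hc.symm.trans ?_⟩
  rw [← Pi.single_smul, Units.smul_def, smul_eq_mul, mul_one]

lemma affinePoint_injective {a b a' b' : ℂ} (h : affinePoint a b = affinePoint a' b') :
    a = a' ∧ b = b' := by
  rw [affinePoint, affinePoint, Projectivization.mk_eq_mk_iff'] at h
  obtain ⟨c, hc⟩ := h
  have h0 := congrFun hc 0
  have h1 := congrFun hc 1
  have h2 := congrFun hc 2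
  simp at h0 h1 h2
  subst h2
  simp at h0 h1
  exact ⟨h0.symm, h1.symm⟩

lemma affinePoint_ne_pointAtInfinity (a b : ℂ) (i : Fin 2) :
    affinePoint a b ≠ pointAtInfinity i := by
  intro h
  obtain ⟨c, hc, h1⟩ := exists_rep_affinePoint a b
  obtain ⟨c', hc', h2⟩ := exists_rep_pointAtInfinity i
  have := congrFun (h1.symm.trans ((congrArg Projectivization.rep h).trans h2)) 2
  fin_cases i <;> simp [hc] at this

lemma pointAtInfinity_injective : Function.Injective pointAtInfinity := by
  intro i j h
  obtain ⟨c, hc, h1⟩ := exists_rep_pointAtInfinity i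
  obtain ⟨c', hc', h2⟩ := exists_rep_pointAtInfinity j
  have := congrFun (h1.symm.trans ((congrArg Projectivization.rep h).trans h2)) i.castSucc
  by_contra hij
  rw [Pi.single_eq_same, Pi.single_eq_of_ne (by simpa using hij)] at this
  exact hc this

lemma chartIndex_affinePoint (a b : ℂ) : chartIndex (affinePoint a b) = 2 := by
  obtain ⟨c, hc, h⟩ := exists_rep_affinePoint a b
  simp [chartIndex, h, hc]

lemma localCoord_affinePoint (a b : ℂ) : localCoord (affinePoint a b) = ![a, b] := by
  obtain ⟨c, hc, h⟩ := exists_rep_affinePoint a b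
  ext j
  rw [localCoord, chartIndex_affinePoint, h]
  fin_cases j
  · exact mul_div_cancel_left₀ a hc
  · exact mul_div_cancel_left₀ b hc

lemma chartIndex_pointAtInfinity (i : Fin 2) : chartIndex (pointAtInfinity i) = i.castSucc := by
  obtain ⟨c, hc, h⟩ := exists_rep_pointAtInfinity i
  rw [chartIndex, h]
  fin_cases i <;> simp [hc]

lemma localCoord_pointAtInfinity (i : Fin 2) : localCoord (pointAtInfinity i) = 0 := by
  obtain ⟨c, hc, h⟩ := exists_rep_pointAtInfinity i
  ext j
  rw [localCoord, chartIndex_pointAtInfinity, h, Pi.single_eq_of_ne (Fin.succAbove_ne _ _),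
    zero_div, Pi.zero_apply]

/-! ### Local equations and singularity types -/

lemma localEquation_affinePoint (a b : ℂ) :
    localEquation (curveC'' 2) (affinePoint a b) =
      X 0 * X 1 * (X 1 ^ 2 + 1) * (X 0 ^ 2 + 1) * (X 0 ^ 2 + X 1 ^ 2 + 1) := by
  have h0 : Fin.insertNth (α := fun _ => MvPolynomial (Fin 2) ℂ) 2 1 X 0 = X 0 := rfl
  have h1 : Fin.insertNth (α := fun _ => MvPolynomial (Fin 2) ℂ) 2 1 X 1 = X 1 := rfl
  have h2 : Fin.insertNth (α := fun _ => MvPolynomial (Fin 2) ℂ) 2 1 X 2 = 1 := rfl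
  rw [localEquation, chartIndex_affinePoint]
  simp only [curveC'', fermat, map_mul, map_add, map_pow, aeval_X, h0, h1, h2, one_pow]

lemma localEquation_pointAtInfinity (i : Fin 2) :
    localEquation (curveC'' 2) (pointAtInfinity i) =
      X 0 * (X 1 ^ 2 + X 0 ^ 2) * ((X 1 ^ 2 + 1) * (X 0 ^ 2 + X 1 ^ 2 + 1)) := by
  rw [localEquation, chartIndex_pointAtInfinity]
  fin_cases i
  · have h0 : Fin.insertNth (α := fun _ => MvPolynomial (Fin 2) ℂ) 0 1 X 0 = 1 := rfl
    have h1 : Fin.insertNth (α := fun _ => MvPolynomial (Fin 2) ℂ) 0 1 X 1 = X 0 := rfl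
    have h2 : Fin.insertNth (α := fun _ => MvPolynomial (Fin 2) ℂ) 0 1 X 2 = X 1 := rfl
    simp only [curveC'', fermat, map_mul, map_add, map_pow, aeval_X, Fin.zero_eta,
      Fin.castSucc_zero, h0, h1, h2, one_pow]
    ring
  · have h0 : Fin.insertNth (α := fun _ => MvPolynomial (Fin 2) ℂ) 1 1 X 0 = X 0 := rfl
    have h1 : Fin.insertNth (α := fun _ => MvPolynomial (Fin 2) ℂ) 1 1 X 1 = 1 := rfl
    have h2 : Fin.insertNth (α := fun _ => MvPolynomial (Fin 2) ℂ) 1 1 X 2 = X 1 := rfl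
    simp only [curveC'', fermat, map_mul, map_add, map_pow, aeval_X, Fin.mk_one,
      Fin.castSucc_one, h0, h1, h2, one_pow]
    ring

lemma tjurinaNumberAt_eq {F : S} {p : P2} {f : MvPolynomial (Fin 2) ℂ} {w : Fin 2 → ℂ}
    (hf : localEquation F p = f) (hw : localCoord p = w) :
    tjurinaNumberAt F p = Module.finrank ℂ (LocalRingAt w ⧸ tjurinaIdeal f w) := by
  subst hf hw
  rfl

lemma isADESingularity_pointAtInfinity (i : Fin 2) :
    IsADESingularity (curveC'' 2) (pointAtInfinity i) ∧
      tjurinaNumberAt (curveC'' 2) (pointAtInfinity i) = 4 := by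
  have hst : IsCoordinatePair (0 : Fin 2 → ℂ) (X 1) (X 0) :=
    ⟨1, 0, 1, 1, by simp, by simp, by simp, by simp, by simp⟩
  have hh : eval (0 : Fin 2 → ℂ) ((X 1 ^ 2 + 1) * (X 0 ^ 2 + X 1 ^ 2 + 1)) ≠ 0 := by simp
  refine ⟨⟨_, .D 4 le_rfl, ?_⟩, ?_⟩
  · rw [localEquation_pointAtInfinity, localCoord_pointAtInfinity]
    exact germEquivalent_D4 hst hh
  · rw [tjurinaNumberAt_eq (localEquation_pointAtInfinity i) (localCoord_pointAtInfinity i)]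
    exact finrank_tjurina_D4 hst hh

lemma isADESingularity_affinePoint {a b : ℂ} (ha : a = 0 ∨ a ^ 2 = -1) (hb : b = 0 ∨ b ^ 2 = -1) :
    IsADESingularity (curveC'' 2) (affinePoint a b) ∧
      tjurinaNumberAt (curveC'' 2) (affinePoint a b) =
        if a = 0 then (if b = 0 then 1 else 6) else (if b = 0 then 6 else 1) := by
  rw [IsADESingularity, tjurinaNumberAt_eq (localEquation_affinePoint a b)
    (localCoord_affinePoint a b), localEquation_affinePoint, localCoord_affinePoint]
  have hne : ∀ {c : ℂ}, c ^ 2 = -1 → c ≠ 0 := by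
    rintro c hc rfl
    norm_num at hc
  have hfac : ∀ {c : ℂ} (i : Fin 2), c ^ 2 = -1 →
      (X i ^ 2 + 1 : MvPolynomial (Fin 2) ℂ) = (X i - C c) * (X i + C c) := by
    intro c i hc
    have : (C c : MvPolynomial (Fin 2) ℂ) ^ 2 = -1 := by rw [← C_pow, hc, C_neg, C_1]
    linear_combination this
  rcases ha with rfl | ha <;> rcases hb with rfl | hb
  · have hst : IsCoordinatePair ![0, 0] (X 0) (X 1) :=
      ⟨0, 1, 1, 1, by simp, by simp, by simp, by simp, by simp⟩
    have hh : eval ![0, 0] ((X 1 ^ 2 + 1) * (X 0 ^ 2 + 1) *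
      (X 0 ^ 2 + X 1 ^ 2 + 1) : MvPolynomial (Fin 2) ℂ) ≠ 0 := by simp
    rw [show (X 0 * X 1 * (X 1 ^ 2 + 1) * (X 0 ^ 2 + 1) * (X 0 ^ 2 + X 1 ^ 2 + 1) :
      MvPolynomial (Fin 2) ℂ) = X 0 * X 1 * ((X 1 ^ 2 + 1) * (X 0 ^ 2 + 1) *
        (X 0 ^ 2 + X 1 ^ 2 + 1)) by ring]
    exact ⟨⟨_, .A 1 le_rfl, germEquivalent_A1 hst hh⟩, by simpa using finrank_tjurina_A1 hst hh⟩
  -- With s = y² + 1 and t = x, the conic is s + t² = 0, tangent to the line s = 0 and crossed by t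
  -- = 0: a D₆ point.
  · have hst : IsCoordinatePair ![0, b] (X 1 ^ 2 + 1) (X 0) :=
      ⟨1, 0, X 1 + C b, 1, by simp, by simpa using hfac 1 hb, by simp,
        by simpa using hne hb, by simp⟩
    have hh : eval ![0, b] (X 1 * (X 0 ^ 2 + 1)) ≠ 0 := by simpa using hne hb
    rw [show (X 0 * X 1 * (X 1 ^ 2 + 1) * (X 0 ^ 2 + 1) * (X 0 ^ 2 + X 1 ^ 2 + 1) :
      MvPolynomial (Fin 2) ℂ) = X 0 * (X 1 ^ 2 + 1) * ((X 1 ^ 2 + 1) + X 0 ^ 2) *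
        (X 1 * (X 0 ^ 2 + 1)) by ring]
    exact ⟨⟨_, .D 6 (by norm_num), germEquivalent_D6 hst hh⟩,
      by simpa [hne hb] using finrank_tjurina_D6 hst hh⟩
  · have hst : IsCoordinatePair ![a, 0] (X 0 ^ 2 + 1) (X 1) :=
      ⟨0, 1, X 0 + C a, 1, by simp, by simpa using hfac 0 ha, by simp,
        by simpa using hne ha, by simp⟩
    have hh : eval ![a, 0] (X 0 * (X 1 ^ 2 + 1)) ≠ 0 := by simpa using hne ha
    rw [show (X 0 * X 1 * (X 1 ^ 2 + 1) * (X 0 ^ 2 + 1) * (X 0 ^ 2 + X 1 ^ 2 + 1) :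
      MvPolynomial (Fin 2) ℂ) = X 1 * (X 0 ^ 2 + 1) * ((X 0 ^ 2 + 1) + X 1 ^ 2) *
        (X 0 * (X 1 ^ 2 + 1)) by ring]
    exact ⟨⟨_, .D 6 (by norm_num), germEquivalent_D6 hst hh⟩,
      by simpa [hne ha] using finrank_tjurina_D6 hst hh⟩
  -- Here x² + y² + 1 = -1, so the conic misses the point and only two lines cross.
  · have hst : IsCoordinatePair ![a, b] (X 0 ^ 2 + 1) (X 1 ^ 2 + 1) :=
      ⟨0, 1, X 0 + C a, X 1 + C b, by simp, by simpa using hfac 0 ha, by simpa using hfac 1 hb,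
        by simpa using hne ha, by simpa using hne hb⟩
    have hh : eval ![a, b] (X 0 * X 1 * (X 0 ^ 2 + X 1 ^ 2 + 1)) ≠ 0 := by
      simp [hne ha, hne hb, ha, hb]
    rw [show (X 0 * X 1 * (X 1 ^ 2 + 1) * (X 0 ^ 2 + 1) * (X 0 ^ 2 + X 1 ^ 2 + 1) :
      MvPolynomial (Fin 2) ℂ) = (X 0 ^ 2 + 1) * (X 1 ^ 2 + 1) *
        (X 0 * X 1 * (X 0 ^ 2 + X 1 ^ 2 + 1)) by ring]
    exact ⟨⟨_, .A 1 le_rfl, germEquivalent_A1 hst hh⟩,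
      by simpa [hne ha, hne hb] using finrank_tjurina_A1 hst hh⟩

/-- The roots `0, i, -i` of `x (x² + 1)`. -/
noncomputable def cubicRoot : Fin 3 → ℂ := ![0, Complex.I, -Complex.I]

lemma cubicRoot_eq (i : Fin 3) : cubicRoot i = 0 ∨ cubicRoot i ^ 2 = -1 := by
  fin_cases i <;> simp [cubicRoot]

lemma cubicRoot_eq_zero_iff (i : Fin 3) : cubicRoot i = 0 ↔ i = 0 := by
  fin_cases i <;> simp [cubicRoot]

lemma cubicRoot_injective : Function.Injective cubicRoot := by
  have h : Complex.I ≠ -Complex.I := fun h => by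
    have := congrArg Complex.im h
    norm_num at this
  intro i j hij
  fin_cases i <;> fin_cases j <;> simp_all [cubicRoot, h.symm, eq_comm]

lemma exists_cubicRoot_eq {c : ℂ} (h : c * (c ^ 2 + 1) = 0) : ∃ i, cubicRoot i = c := by
  rcases mul_eq_zero.mp h with h | h
  · exact ⟨0, h.symm⟩
  · have : (c - Complex.I) * (c + Complex.I) = 0 := by linear_combination h - Complex.I_sq
    rcases mul_eq_zero.mp this with h | h
    · exact ⟨1, (sub_eq_zero.mp h).symm⟩
    · exact ⟨2, (eq_neg_of_add_eq_zero_left h).symm⟩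

lemma isSingularPoint_curveC''_two_iff_exists (p : P2) :
    IsSingularPoint (curveC'' 2) p ↔
      (∃ i j, affinePoint (cubicRoot i) (cubicRoot j) = p) ∨ ∃ i, pointAtInfinity i = p := by
  rw [isSingularPoint_curveC''_two_iff]
  constructor
  · rintro (⟨hz, hx, hy⟩ | ⟨hz, hxy⟩)
    · left
      have hroot : ∀ x : ℂ, x * (x ^ 2 + p.rep 2 ^ 2) = 0 → ∃ i, cubicRoot i = x / p.rep 2 := by
        intro x hx
        refine exists_cubicRoot_eq ?_
        field_simp
        linear_combination hx
      obtain ⟨i, hi⟩ := hroot _ hx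
      obtain ⟨j, hj⟩ := hroot _ hy
      refine ⟨i, j, ?_⟩
      rw [hi, hj, affinePoint, ← p.mk_rep, Projectivization.mk_eq_mk_iff']
      refine ⟨(p.rep 2)⁻¹, ?_⟩
      ext k
      fin_cases k <;> simp <;> field_simp
    · right
      rcases hxy with h | h
      · refine ⟨1, ?_⟩
        rw [pointAtInfinity, ← p.mk_rep, Projectivization.mk_eq_mk_iff']
        have h1 : p.rep 1 ≠ 0 := fun h1 => p.rep_nonzero (by ext k; fin_cases k <;> assumption)
        refine ⟨(p.rep 1)⁻¹, ?_⟩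
        ext k
        fin_cases k <;> simp [h, hz, h1]
      · refine ⟨0, ?_⟩
        rw [pointAtInfinity, ← p.mk_rep, Projectivization.mk_eq_mk_iff']
        have h1 : p.rep 0 ≠ 0 := fun h1 => p.rep_nonzero (by ext k; fin_cases k <;> assumption)
        refine ⟨(p.rep 0)⁻¹, ?_⟩
        ext k
        fin_cases k <;> simp [h, hz, h1]
  · rintro (⟨i, j, rfl⟩ | ⟨i, rfl⟩)
    · left
      obtain ⟨c, hc, h⟩ := exists_rep_affinePoint (cubicRoot i) (cubicRoot j)
      have hroot : ∀ i, c * cubicRoot i * ((c * cubicRoot i) ^ 2 + c ^ 2) = 0 := by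
        intro i
        rcases cubicRoot_eq i with h | h
        · simp [h]
        · rw [mul_pow, h]
          ring
      rw [h]
      exact ⟨hc, hroot i, hroot j⟩
    · right
      obtain ⟨c, hc, h⟩ := exists_rep_pointAtInfinity i
      rw [h]
      fin_cases i <;> simp

lemma totalTjurinaNumber_curveC''_two : totalTjurinaNumber (curveC'' 2) = 37 := by
  classical
  let e : (Fin 3 × Fin 3) ⊕ Fin 2 → P2 :=
    Sum.elim (fun x => affinePoint (cubicRoot x.1) (cubicRoot x.2)) pointAtInfinity
  have he : Function.Injective e := by
    refine Function.Injective.sumElim ?_ pointAtInfinity_injective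
      fun x i => affinePoint_ne_pointAtInfinity _ _ i
    rintro ⟨i, j⟩ ⟨i', j'⟩ h
    obtain ⟨h1, h2⟩ := affinePoint_injective h
    exact Prod.ext (cubicRoot_injective h1) (cubicRoot_injective h2)
  have hset : {p : P2 | IsSingularPoint (curveC'' 2) p} = Set.range e := by
    ext p
    simp [e, isSingularPoint_curveC''_two_iff_exists]
  rw [totalTjurinaNumber, hset, finsum_mem_range he, finsum_eq_sum_of_fintype,
    Fintype.sum_sum_type, Fintype.sum_prod_type]
  simp only [e, Sum.elim_inl, Sum.elim_inr, (isADESingularity_pointAtInfinity _).2,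
    (isADESingularity_affinePoint (cubicRoot_eq _) (cubicRoot_eq _)).2, cubicRoot_eq_zero_iff]
  decide

lemma isMaximizing_curveC''_two : IsMaximizing (curveC'' 2) 8 := by
  refine ⟨⟨isHomogeneous_curveC'' 2, squarefree_curveC'' two_ne_zero⟩, fun p hp => ?_,
    .inl ⟨4, by norm_num, totalTjurinaNumber_curveC''_two⟩⟩
  rcases (isSingularPoint_curveC''_two_iff_exists p).mp hp with ⟨i, j, rfl⟩ | ⟨i, rfl⟩
  · exact (isADESingularity_affinePoint (cubicRoot_eq i) (cubicRoot_eq j)).1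
  · exact (isADESingularity_pointAtInfinity i).1

end Octic

end PlaneCurve

theorem mainTheorem2 (d : ℕ) (hd : 1 ≤ d) :
    -- the Fermat curve is a smooth reduced curve of degree `d`
    (PlaneCurve.IsReducedCurve (PlaneCurve.fermat d) d ∧
      ∀ p, ¬ PlaneCurve.IsSingularPoint (PlaneCurve.fermat d) p) ∧
    -- its inflectional tangents
    (3 ≤ d →
      (PlaneCurve.inflectionalTangents (PlaneCurve.fermat d)).ncard = 3 * d ∧
      ⋃₀ PlaneCurve.inflectionalTangents (PlaneCurve.fermat d) =
        PlaneCurve.zeroLocus (PlaneCurve.arrangementA d)) ∧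
    -- the curve `C'`
    PlaneCurve.zeroLocus (PlaneCurve.curveC' d) =
      PlaneCurve.zeroLocus (PlaneCurve.fermat d) ∪
        PlaneCurve.zeroLocus (PlaneCurve.arrangementA d) ∪
        ⋃ i : Fin 3, PlaneCurve.zeroLocus (MvPolynomial.X i) ∧
    PlaneCurve.IsFreeCurve (PlaneCurve.curveC' d) (4 * d + 3) (2 * d + 1) (2 * d + 1) ∧
    -- the curve `C''`
    PlaneCurve.curveC'' d ∣ PlaneCurve.curveC' d ∧
    PlaneCurve.IsFreeCurve (PlaneCurve.curveC'' d) (3 * d + 2) (d + 1) (2 * d) ∧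
    (d = 2 → PlaneCurve.IsMaximizing (PlaneCurve.curveC'' d) 8) := by
  have hd0 : d ≠ 0 := Nat.one_le_iff_ne_zero.mp hd
  refine ⟨⟨⟨PlaneCurve.isHomogeneous_fermat d, PlaneCurve.squarefree_fermat hd0⟩,
    PlaneCurve.not_isSingularPoint_fermat hd0⟩,
    fun h3 => ⟨PlaneCurve.ncard_inflectionalTangents_fermat h3,
      PlaneCurve.sUnion_inflectionalTangents_fermat h3⟩,
    PlaneCurve.zeroLocus_curveC' d, PlaneCurve.isFreeCurve_curveC' hd0,
    PlaneCurve.curveC''_dvd_curveC' d, PlaneCurve.isFreeCurve_curveC'' hd0, ?_⟩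
  rintro rfl
  exact PlaneCurve.isMaximizing_curveC''_two
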